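/- Let $\mathbb L=\mathbb Z[q^{\pm1},s^{\pm1}]$, and let $V$ be the generic integral Verma module of $U_q(\mathfrak{sl}_2)$: the free $\mathbb L$-module on $v_0,v_1,\dots$ with $$K v_j=sq^{-2j}v_j,\qquad E v_j=v_{j-1}\ (Ev_0=0),\qquad F^{(m)}v_j={m+j\brack j}_q\prod_{k=0}^{m-1}\bigl(sq^{-k-j}-s^{-1}q^{k+j}\bigr)\,v_{j+m},$$ where ${a\brack b}_q=\frac{[a]_q!}{[b]_q!\,[a-b]_q!}$ with $[a]_q=\frac{q^a-q^{-a}}{q-q^{-1}}$. On $V^{\otimes n}$ ($n\ge 1$) let $K$ act by $K^{\otimes n}$ and $E$ by $\sum_{i}1^{\otimes(i-1)}\otimes E\otimes K^{\otimes(n-i)}$. For $l\ge 0$ put $V_{n,l}=\ker(K-s^nq^{-2l})\subset V^{\otimes n}$ and $W_{n,l}=\ker(E)\cap V_{n,l}$. Let $R:V\otimes V\to V\otimes V$ be $$R(v_i\otimes v_j)=s^{-(i+j)}\sum_{m=0}^{i}q^{2(i-m)(j+m)}q^{m(m-1)/2}{m+j\brack j}_q\prod_{k=0}^{m-1}\bigl(sq^{-k-j}-s^{-1}q^{k+j}\bigr)\,v_{j+m}\otimes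 v_{i-m},$$ and $\sigma_i=1^{\otimes(i-1)}\otimes R\otimes1^{\otimes(n-i-1)}$ for $1\le i\le n-1$. Write $v_\beta=v_{\beta_1}\otimes\cdots\otimes v_{\beta_n}$ and $|\beta|=\sum_i\beta_i$ for $\beta\in\mathbb Z_{\ge0}^n$. For $l\ge1$ let $\mathcal A_{n,l}$ be the set of all $v_\beta$ with $|\beta|=l$ whose first nonzero entry equals $1$ and is not the last entry; these are the vectors $a_{\alpha}=v_0^{\otimes(j-2)}\otimes v_1\otimes v_{\alpha}$ with $2\le j\le n$, $\alpha=(\alpha_j,\dots,\alpha_n)$ and $\sum_i\alpha_i=l-1$. Let $\mathcal B_{n,l}$ be the set of the remaining $v_\beta$ with $|\beta|=l$. For $l=0$ put $\mathcal A_{n,0}=\{v_0^{\otimes n}\}$, $\mathcal B_{n,0}=\emptyset$. Define $\Phi$ on $V_{n,l}$ as the identity on $\mathcal B_{n,l}$ and on $v_0^{\otimes n}$, and by $$\Phi(a_\alpha)=\sum_{k\ge0}(-1)^{k-1}s^{(k-1)(j-n-1)}q^{(k-1)(2l-k-2)}\;v_0^{\otimes(j-2)}\otimes v_k\otimes E^{k-1}v_\alpha,$$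 where $E^{-1}v_\alpha$ denotes the element $\eta$ of the $\mathbb L$-span of $\mathcal B_{n-j+1,l}$ with $E\eta=v_\alpha$. **Theorem.** Let $n\ge1$ and $l\ge0$. 1. For all $m,k$ with $m\ge1$, $k\ge0$, every $x\in V_{m,k}$ equals $E\eta$ for a unique $\eta$ in the span of $\mathcal B_{m,k+1}$; so $\Phi$ is well defined. 2. $W_{n,l}$ is a free $\mathbb L$-module of rank $\binom{n+l-2}{l}$, with basis the family of the vectors $\Phi(a)$, $a\in\mathcal A_{n,l}$; that is, $w_\alpha=\Phi(a_\alpha)$ for $l\ge1$, and $v_0^{\otimes n}$ for $l=0$. (For $n=1$, $l=0$ the binomial coefficient $\binom{-1}{0}$ is read as $1$.) 3. The operators $\sigma_i$ preserve $W_{n,l}$ and define an action of the braid group $B_n$ on it by $\mathbb L$-linear automorphisms, with the $i$-th Artin generator acting by $\sigma_i|_{W_{n,l}}$. Hence, in the above basis (in some order), one obtains a homomorphism $$\rho_{n,l}:B_n\longrightarrow \mathrm{GL}\Bigl(\tbinom{n+l-2}{l},\mathbb L\Bigr)\cong\mathrm{Aut}_{\mathbb L}(W_{n,l}).$$ -/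

import Mathlib

open scoped TensorProduct

noncomputable section

namespace QVerma

/-! ### The ground ring and quantum numbers -/

/-- The ring of two-variable Laurent polynomials over `ℤ`:
the inner variable is `q`, the outer one is `s`. -/
abbrev LL : Type := LaurentPolynomial (LaurentPolynomial ℤ)

/-- The variable `q`, as a unit. -/
def qU : LLˣ where
  val := LaurentPolynomial.C (LaurentPolynomial.T 1)
  inv := LaurentPolynomial.C (LaurentPolynomial.T (-1))
  val_inv := by rw [← map_mul, ← LaurentPolynomial.T_add]; simp
  inv_val := by rw [← map_mul, ← LaurentPolynomial.T_add]; simp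

/-- The variable `s`, as a unit. -/
def sU : LLˣ where
  val := LaurentPolynomial.T 1
  inv := LaurentPolynomial.T (-1)
  val_inv := by rw [← LaurentPolynomial.T_add]; simp
  inv_val := by rw [← LaurentPolynomial.T_add]; simp

/-- The integral power `q ^ z`. -/
def qp (z : ℤ) : LL := ((qU ^ z : LLˣ) : LL)

/-- The integral power `s ^ z`. -/
def sp (z : ℤ) : LL := ((sU ^ z : LLˣ) : LL)

/-- The quantum integer `[n] = q^(n-1) + q^(n-3) + ⋯ + q^(1-n)`. -/
def qInt (n : ℕ) : LL := ∑ i ∈ Finset.range n, qp ((n : ℤ) - 1 - 2 * i)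

/-- The quantum factorial. -/
def qFact : ℕ → LL
  | 0 => 1
  | n + 1 => qInt (n + 1) * qFact n

/-- The quantum binomial coefficient `[n]! / ([k]! [n-k]!)`, through the Pascal rule; it is shown
below that it is this quotient. -/
def qBinom : ℕ → ℕ → LL
  | _, 0 => 1
  | 0, _ + 1 => 0
  | n + 1, k + 1 => qp ((k : ℤ) + 1) * qBinom n (k + 1) + qp ((k : ℤ) - n) * qBinom n k

theorem qp_add (a b : ℤ) : qp (a + b) = qp a * qp b := by
  simp [qp, zpow_add]

/-- `(q - q⁻¹) [n] = q^n - q^(-n)`. -/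
theorem sub_mul_qInt (n : ℕ) : (qp 1 - qp (-1)) * qInt n = qp n - qp (-n) := by
  have h : ∀ m : ℕ, m ≤ n →
      (qp 1 - qp (-1)) * ∑ i ∈ Finset.range m, qp ((n : ℤ) - 1 - 2 * i)
        = qp n - qp ((n : ℤ) - 2 * m) := by
    intro m
    induction m with
    | zero => simp
    | succ m ih =>
      intro hm
      rw [Finset.sum_range_succ, mul_add, ih (by omega), sub_mul, ← qp_add, ← qp_add]
      have e1 : (1 : ℤ) + (n - 1 - 2 * m) = n - 2 * m := by ring
      have e2 : (-1 : ℤ) + (n - 1 - 2 * m) = n - 2 * ((m + 1 : ℕ) : ℤ) := by push_cast; ring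
      rw [e1, e2]
      ring
  have := h n le_rfl
  rw [qInt, this]
  congr 2
  ring

theorem qInt_add (a b : ℕ) : qInt (a + b) = qp a * qInt b + qp (-b) * qInt a := by
  rw [qInt, add_comm a b, Finset.sum_range_add, qInt, qInt, Finset.mul_sum, Finset.mul_sum]
  congr 1 <;> refine Finset.sum_congr rfl fun i _ => ?_ <;> rw [← qp_add] <;> congr 1 <;>
    push_cast <;> ring

theorem qBinom_zero_right (n : ℕ) : qBinom n 0 = 1 := by
  cases n <;> rfl

theorem qBinom_eq_zero (n : ℕ) : ∀ k, n < k → qBinom n k = 0 := by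
  induction n with
  | zero => intro k hk; cases k with
    | zero => omega
    | succ k => rfl
  | succ n ih => intro k hk; cases k with
    | zero => omega
    | succ k => rw [qBinom, ih _ (by omega), ih _ (by omega)]; simp

/-- The quantum binomial coefficient is the expected quotient of factorials. -/
theorem qBinom_mul (a b : ℕ) : qBinom (a + b) a * (qFact a * qFact b) = qFact (a + b) := by
  obtain ⟨N, hN⟩ : ∃ N, N = a + b := ⟨_, rfl⟩
  induction N generalizing a b with
  | zero =>
    obtain rfl : a = 0 := by omega
    obtain rfl : b = 0 := by omega
    simp [qBinom, qFact]
  | succ N ih =>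
    cases a with
    | zero => simp [qBinom_zero_right, qFact]
    | succ a =>
      cases b with
      | zero =>
        have h := ih a 0 (by omega)
        simp only [add_zero] at h
        rw [add_zero, qBinom, qBinom_eq_zero a (a + 1) (by omega)]
        simp only [mul_zero, zero_add, sub_self]
        have hq : qFact (a + 1) = qInt (a + 1) * qFact a := rfl
        have h0 : qFact 0 = 1 := rfl
        have h00 : qp 0 = 1 := by simp [qp]
        rw [h0, mul_one] at h
        rw [hq, h0, h00]
        linear_combination qInt (a + 1) * h
      | succ b =>
        have h1 := ih (a + 1) b (by omega)
        have h2 := ih a (b + 1) (by omega)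
        have e1 : a + 1 + (b + 1) = (a + b + 1) + 1 := by omega
        rw [show a + 1 + b = a + b + 1 by omega] at h1
        rw [show a + (b + 1) = a + b + 1 by omega] at h2
        have h3 := qInt_add (a + 1) (b + 1)
        rw [e1] at h3 ⊢
        have hN' : qFact (a + b + 1 + 1) = qInt (a + b + 1 + 1) * qFact (a + b + 1) := rfl
        rw [qBinom, hN', h3]
        have e2 : (a : ℤ) - ((a + b + 1 : ℕ) : ℤ) = -((b + 1 : ℕ) : ℤ) := by push_cast; ring
        have e3 : (a : ℤ) + 1 = ((a + 1 : ℕ) : ℤ) := by push_cast; ring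
        have hb : qFact (b + 1) = qInt (b + 1) * qFact b := rfl
        have ha : qFact (a + 1) = qInt (a + 1) * qFact a := rfl
        rw [hb] at h2 ⊢
        rw [ha] at h1 ⊢
        rw [e2, e3]
        linear_combination qp ((a + 1 : ℕ) : ℤ) * qInt (b + 1) * h1 +
          qp (-((b + 1 : ℕ) : ℤ)) * qInt (a + 1) * h2

/-! ### The generic integral Verma module -/

/-- The generic Verma module: the free `LL`-module on `v 0, v 1, v 2, …`. -/
abbrev V : Type := ℕ →₀ LL

/-- The basis vector `v j`. -/
def v (j : ℕ) : V := Finsupp.single j 1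

/-- The standard basis of `V`. -/
def vBasis : Module.Basis ℕ LL V := Finsupp.basisSingleOne

/-- `K v_j = s q^(-2j) v_j`. -/
def K : V →ₗ[LL] V := vBasis.constr LL fun j => (sp 1 * qp (-2 * j)) • v j

/-- `E v_j = v_(j-1)` and `E v_0 = 0`. -/
def E : V →ₗ[LL] V := vBasis.constr LL fun j => if j = 0 then 0 else v (j - 1)

/-- The divided power `F^(m)`. -/
def F (m : ℕ) : V →ₗ[LL] V := vBasis.constr LL fun j =>
  (qBinom (m + j) j *
    ∏ k ∈ Finset.range m, (sp 1 * qp (-(k : ℤ) - j) - sp (-1) * qp ((k : ℤ) + j))) • v (j + m)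

/-! ### The braiding on `V ⊗ V` -/

/-- The basis `v_i ⊗ v_j` of `V ⊗ V`. -/
def vvBasis : Module.Basis (ℕ × ℕ) LL (V ⊗[LL] V) := vBasis.tensorProduct vBasis

/-- The action of the locally finite sum `∑ m, q^(m(m-1)/2) E^m ⊗ F^(m)`; the terms with
`m > i` vanish on `v_i ⊗ v_j`. -/
def Pmap : V ⊗[LL] V →ₗ[LL] V ⊗[LL] V := vvBasis.constr LL fun p =>
  ∑ m ∈ Finset.range (p.1 + 1),
    qp (((m * (m - 1) / 2 : ℕ) : ℤ)) • (((E ^ m) (v p.1)) ⊗ₜ[LL] (F m (v p.2)))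

/-- The diagonal part `v_i ⊗ v_j ↦ s^(-(i+j)) q^(2ij) v_i ⊗ v_j`. -/
def Cmap : V ⊗[LL] V →ₗ[LL] V ⊗[LL] V := vvBasis.constr LL fun p =>
  (sp (-((p.1 : ℤ) + p.2)) * qp (2 * p.1 * p.2)) • (v p.1 ⊗ₜ[LL] v p.2)

/-- The braiding: the action of the (normalised) universal R-matrix, followed by the flip. -/
def R : V ⊗[LL] V →ₗ[LL] V ⊗[LL] V :=
  (TensorProduct.comm LL V V).toLinearMap ∘ₗ Cmap ∘ₗ Pmap

/-! ### Tensor powers -/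

/-- The tensor power `V^{⊗ n}`. -/
abbrev Vpow (n : ℕ) : Type := ⨂[LL] _ : Fin n, V

instance instAddCommGroupVpow (n : ℕ) : AddCommGroup (Vpow n) :=
  Module.addCommMonoidToAddCommGroup LL

/-- The basis of `V^{⊗ n}` given by the `v_{β_1} ⊗ ⋯ ⊗ v_{β_n}`. -/
def vpBasis (n : ℕ) : Module.Basis (Fin n → ℕ) LL (Vpow n) :=
  Basis.piTensorProduct fun _ => vBasis

/-- The basis vector `v_{β_1} ⊗ ⋯ ⊗ v_{β_n}`. -/
def vt {n : ℕ} (β : Fin n → ℕ) : Vpow n := PiTensorProduct.tprod LL fun i => v (β i)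

theorem vpBasis_apply {n : ℕ} (β : Fin n → ℕ) : vpBasis n β = vt β := by
  rw [vpBasis, Basis.piTensorProduct_apply]
  rfl

/-- The action of `K` on `V^{⊗ n}` through the iterated coproduct `K ⊗ ⋯ ⊗ K`. -/
def Kn (n : ℕ) : Vpow n →ₗ[LL] Vpow n := PiTensorProduct.map fun _ => K

/-- The action of `E` on `V^{⊗ n}` through the iterated coproduct
`∑ i, 1 ⊗ ⋯ ⊗ 1 ⊗ E ⊗ K ⊗ ⋯ ⊗ K` (with `E` in position `i`), where `Δ E = E ⊗ K + 1 ⊗ E`. -/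
def En (n : ℕ) : Vpow n →ₗ[LL] Vpow n :=
  ∑ i : Fin n, PiTensorProduct.map (R := LL) (s := fun _ : Fin n => V) (t := fun _ => V) fun j =>
    (if j < i then LinearMap.id else if j = i then E else K : V →ₗ[LL] V)

/-- The weight space `V_{n,l} = ker (K - s^n q^(-2l))`. -/
def weightSpace (n l : ℕ) : Submodule LL (Vpow n) :=
  LinearMap.ker (Kn n - (sp n * qp (-2 * l)) • (LinearMap.id : Vpow n →ₗ[LL] Vpow n))

/-- The highest weight space `W_{n,l} = ker E ∩ V_{n,l}`. -/
def W (n l : ℕ) : Submodule LL (Vpow n) := LinearMap.ker (En n) ⊓ weightSpace n l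

/-! ### The braid group and its generators on `V^{⊗ n}` -/

/-- The defining relators of the braid group on `n` strands. -/
def braidRels (n : ℕ) : Set (FreeGroup (Fin (n - 1))) :=
  {r | ∃ i j : Fin (n - 1), (i : ℕ) + 1 = j ∧
      r = FreeGroup.of i * FreeGroup.of j * FreeGroup.of i *
        (FreeGroup.of j * FreeGroup.of i * FreeGroup.of j)⁻¹} ∪
  {r | ∃ i j : Fin (n - 1), (i : ℕ) + 1 < j ∧
      r = FreeGroup.of i * FreeGroup.of j * (FreeGroup.of j * FreeGroup.of i)⁻¹}

/-- The braid group `B_n`, by Artin's presentation. -/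
abbrev BraidGroup (n : ℕ) : Type := PresentedGroup (braidRels n)

/-- The Artin generators of `B_n` (numbered from `0`). -/
def artin {n : ℕ} (i : Fin (n - 1)) : BraidGroup n := PresentedGroup.of i

/-- For vectors `x_k` (`k < n`), the map `V ⊗ V → V^{⊗ n}` which puts the two tensor factors in
the positions `i`, `i + 1` and `x_k` in every other position `k`. -/
def insertPair {n : ℕ} (i : Fin (n - 1)) (x : Fin n → V) : V ⊗[LL] V →ₗ[LL] Vpow n :=
  have hne : (⟨i + 1, by omega⟩ : Fin n) ≠ ⟨i, by omega⟩ := by simp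
  TensorProduct.lift <| LinearMap.mk₂ LL
    (fun a b => PiTensorProduct.tprod LL
      (Function.update (Function.update x ⟨i, by omega⟩ a) ⟨i + 1, by omega⟩ b))
    (fun a a' b => by
      simp only [Function.update_comm (β := fun _ : Fin n => V) hne.symm _ b, MultilinearMap.map_update_add])
    (fun c a b => by
      simp only [Function.update_comm (β := fun _ : Fin n => V) hne.symm _ b, MultilinearMap.map_update_smul])
    (fun a b b' => by simp only [MultilinearMap.map_update_add])
    (fun c a b => by simp only [MultilinearMap.map_update_smul])

/-- The operator `σ_i = id ⊗ ⋯ ⊗ id ⊗ R ⊗ id ⊗ ⋯ ⊗ id` on `V^{⊗ n}`, with `R` acting on the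
positions `i`, `i + 1` (numbered from `0`). -/
def sigma {n : ℕ} (i : Fin (n - 1)) : Vpow n →ₗ[LL] Vpow n :=
  (vpBasis n).constr LL fun β =>
    insertPair i (fun k => v (β k))
      (R (v (β ⟨i, by omega⟩) ⊗ₜ[LL] v (β ⟨i + 1, by omega⟩)))

/-! ### The explicit basis -/

/-- The first nonzero entry of `β` is `1`, and is not the last entry of `β`. (For total degree
`≥ 2` the second condition is automatic; in degree `1` it is the convention that excludes
`v_0 ⊗ ⋯ ⊗ v_0 ⊗ v_1`.) -/
def IsA {n : ℕ} (β : Fin n → ℕ) : Prop :=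
  ∃ k : Fin n, (∀ j < k, β j = 0) ∧ β k = 1 ∧ (k : ℕ) + 1 < n

/-- The first nonzero entry of `β` is at least `2`, or is `1` in the last position. (The second
case occurs in total degree `1` only.) -/
def IsB {n : ℕ} (β : Fin n → ℕ) : Prop :=
  ∃ k : Fin n, (∀ j < k, β j = 0) ∧ (1 < β k ∨ (β k = 1 ∧ (k : ℕ) + 1 = n))

/-- The index set of `𝒜_{n,l}`. For `l = 0` it consists of the zero sequence. -/
def setA (n l : ℕ) : Set (Fin n → ℕ) := {β | ∑ i, β i = l ∧ (IsA β ∨ l = 0)}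

/-- The span of `ℬ_{n,l}`. -/
def spanB (n l : ℕ) : Submodule LL (Vpow n) :=
  Submodule.span LL (vt '' {β : Fin n → ℕ | ∑ i, β i = l ∧ IsB β})

/-- For `x` in `V_{m,l-1}`, the element `η` of the span of `ℬ_{m,l}` with `E η = x`. -/
def Einv (m l : ℕ) (x : Vpow m) : Vpow m :=
  Classical.epsilon fun η => η ∈ spanB m l ∧ En m η = x

/-- The sequence `(0, …, 0, k, α)` with `p` zeros in front. -/
def pad {n : ℕ} (p k : ℕ) (α : Fin (n - p - 1) → ℕ) : Fin n → ℕ := fun i =>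
  if h : p < i then α ⟨i - p - 1, by omega⟩ else if (i : ℕ) = p then k else 0

/-- The linear map `y ↦ v_0^{⊗ p} ⊗ v_k ⊗ y`. -/
def prepend (n p k : ℕ) : Vpow (n - p - 1) →ₗ[LL] Vpow n :=
  (vpBasis (n - p - 1)).constr LL fun α => vt (pad p k α)

/-- `E^(k-1) v_α`, where `E⁻¹ v_α` is the element of the span of `ℬ` described above. -/
def Epow {m : ℕ} (α : Fin m → ℕ) : ℕ → Vpow m
  | 0 => Einv m ((∑ i, α i) + 1) (vt α)
  | k + 1 => (En m ^ k) (vt α)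

/-- The coefficient `(-1)^(k-1) s^((k-1)(j-n-1)) q^((k-1)(2l-k-2))`. -/
def bCoeff (n l j k : ℕ) : LL :=
  (((-1 : LLˣ) ^ ((k : ℤ) - 1) : LLˣ) : LL) * sp (((k : ℤ) - 1) * ((j : ℤ) - n - 1)) *
    qp (((k : ℤ) - 1) * (2 * (l : ℤ) - k - 2))

/-- The vector `∑ k, b_{α,k} v_0^{⊗ (j-2)} ⊗ v_k ⊗ E^(k-1) v_α`, for `j = p + 2`, a sequence
`α` of length `n - j + 1` and `l = |α| + 1`. The terms with `k > l` vanish. -/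
def phiA {n : ℕ} (p : ℕ) (α : Fin (n - p - 1) → ℕ) : Vpow n :=
  ∑ k ∈ Finset.range ((∑ i, α i) + 2),
    bCoeff n ((∑ i, α i) + 1) (p + 2) k • prepend n p k (Epow α k)

open Classical in
/-- The map `Φ` on all `V_{n,l}` simultaneously: `v_0^{⊗ (j-2)} ⊗ v_1 ⊗ v_α` goes to the above
sum if `α` is a sequence of length `≥ 1`, and all other basis vectors are fixed. -/
def Phi (n : ℕ) : Vpow n →ₗ[LL] Vpow n :=
  (vpBasis n).constr LL fun β =>
    if h : ∃ p : ℕ, p + 1 < n ∧ ∃ α : Fin (n - p - 1) → ℕ, β = pad p 1 α then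
      phiA h.choose h.choose_spec.2.choose
    else vt β

theorem pad_inj {n p p' : ℕ} (hp : p < n) (hp' : p' < n)
    {α : Fin (n - p - 1) → ℕ} {α' : Fin (n - p' - 1) → ℕ}
    (h : (pad p 1 α : Fin n → ℕ) = pad p' 1 α') : p = p' ∧ HEq α α' := by
  have hpp : p = p' := by
    rcases lt_trichotomy p p' with hlt | heq | hlt
    · have := congrFun h ⟨p, hp⟩
      simp [pad, hlt.ne, not_lt.2 hlt.le] at this
    · exact heq
    · have := congrFun h ⟨p', hp'⟩
      simp [pad, hlt.ne, not_lt.2 hlt.le] at this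
  subst hpp
  refine ⟨rfl, heq_of_eq (funext fun i => ?_)⟩
  have := congrFun h ⟨p + 1 + i, by omega⟩
  have hlt : p < p + 1 + (i : ℕ) := by omega
  have e : p + 1 + (i : ℕ) - p - 1 = i := by omega
  simpa [pad, hlt, e] using this

/-- `Φ` takes the expected value on the vectors `v_0^{⊗ p} ⊗ v_1 ⊗ v_α`. -/
theorem Phi_pad {n p : ℕ} (hp : p + 1 < n) (α : Fin (n - p - 1) → ℕ) :
    Phi n (vt (pad p 1 α)) = phiA p α := by
  rw [← vpBasis_apply, Phi, Module.Basis.constr_basis]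
  have h : ∃ p' : ℕ, p' + 1 < n ∧ ∃ α' : Fin (n - p' - 1) → ℕ,
      (pad p 1 α : Fin n → ℕ) = pad p' 1 α' := ⟨p, hp, α, rfl⟩
  rw [dif_pos h]
  have key : ∀ (p' : ℕ) (α' : Fin (n - p' - 1) → ℕ), p = p' → HEq α α' →
      (phiA p' α' : Vpow n) = phiA p α := by
    rintro p' α' rfl hα
    rw [eq_of_heq hα]
  have := pad_inj (by omega) (by have := h.choose_spec.1; omega) h.choose_spec.2.choose_spec
  exact key _ _ this.1 this.2

end QVerma

end

/-!
Let `ΔE = E ⊗ K + 1 ⊗ E` be the coproduct of `E`.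

*Inverting `E`.* Raising the first nonzero entry of `γ` (the last entry if `γ = 0`) is a bijection
`raise` from the sequences of degree `k` onto the index set of `ℬ_{n,k+1}`. The leading term of
`E v_(raise γ)` is a unit times `v_γ`, and in all other terms `v_δ` a later entry was lowered, so
that `∑ i, i δ_i` is smaller. Hence `v_γ ↦ E v_(raise γ)` is a surjective endomorphism of `V_{n,k}`
(`vt_mem_map_En`). As `V_{n,k}` is finitely generated, it is bijective, so `E` maps the span of
`ℬ_{n,k+1}` bijectively onto `V_{n,k}` (`existsUnique_En_eq`).

*The basis.* The coefficients of `Φ (a)` are chosen such that `E Φ (a)` telescopes to zero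
(`En_phiA`), and `Φ (a) - a` lies in the span of `ℬ` (`Phi_sub_mem_spanB`). Since `V_{n,l}` is the
direct sum of the spans of `𝒜` and `ℬ`, and `E` is injective on the span of `ℬ`, the vectors `Φ (a)`
form a basis of `ker E ∩ V_{n,l}`. Their number is `#{|β| = l} - #{|γ| = l - 1}`.

*The braid group.* By the two Pascal rules for quantum binomials, `R` commutes with `ΔE`
(`R_comp_deltaE`), so `σ_i` commutes with the action of `E` on `V^{⊗ n}` and preserves `W_{n,l}`.
It is bijective on `V_{n,l}`, again by triangularity and finite generation. For the braid relation,
`σ_i σ_{i+1}` is rewritten as the braiding of `V ⊗ V` with `V`, which is the `R`-matrix with `E`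
replaced by `ΔE` (`sigma_sigma_insertPair`); this is the `q`-binomial theorem for `(ΔE)^N`
(`deltaE_pow_v_tmul_v`) combined with `F^(k) F^(m) = [k+m choose m] F^(k+m)`. As `R` commutes with
`ΔE` and preserves degrees, it can be moved past this braiding (`sigma_hexMap`), which is the braid
relation (`sigma_braid`).
-/

noncomputable section

namespace QVerma

/-! ### Powers of `q` and `s`, quantum numbers -/

theorem qp_zero : qp 0 = 1 := by simp [qp]

theorem sp_zero : sp 0 = 1 := by simp [sp]

theorem sp_add (a b : ℤ) : sp (a + b) = sp a * sp b := by
  simp [sp, zpow_add]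

theorem isUnit_qp (z : ℤ) : IsUnit (qp z) := (qU ^ z).isUnit

theorem isUnit_sp (z : ℤ) : IsUnit (sp z) := (sU ^ z).isUnit

theorem qp_natCast_mul (z : ℤ) (n : ℕ) : qp (n * z) = qp z ^ n := by
  induction n with
  | zero => simp [qp_zero]
  | succ n ih => rw [pow_succ, ← ih, ← qp_add]; congr 1; push_cast; ring

theorem sp_natCast (n : ℕ) : sp n = sp 1 ^ n := by
  induction n with
  | zero => simp [sp_zero]
  | succ n ih => rw [pow_succ, ← ih, ← sp_add]; congr 1

theorem qp_eq_C_T (z : ℤ) : qp z = LaurentPolynomial.C (LaurentPolynomial.T z) := by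
  have h : ∀ n : ℕ, qp n = LaurentPolynomial.C (LaurentPolynomial.T n) := by
    intro n
    have h1 : qp 1 = LaurentPolynomial.C (LaurentPolynomial.T 1) := by simp [qp, qU]
    rw [← mul_one (n : ℤ), qp_natCast_mul, h1, ← map_pow, LaurentPolynomial.T_pow]
  obtain ⟨n, rfl | rfl⟩ := z.eq_nat_or_neg
  · exact h n
  · apply (isUnit_qp n).mul_left_cancel
    rw [← qp_add, h n, ← map_mul, ← LaurentPolynomial.T_add]
    simp [qp_zero]

theorem qp_injective : Function.Injective qp := by
  intro a b h
  rw [qp_eq_C_T, qp_eq_C_T] at h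
  have h' : (LaurentPolynomial.T a : LaurentPolynomial ℤ) = LaurentPolynomial.T b := by
    have := congrArg (fun f : LL => f.coeff 0) h
    simpa only [LaurentPolynomial.C_apply, if_true] using this
  exact AddMonoidAlgebra.single_left_injective one_ne_zero h'

theorem qFact_ne_zero (n : ℕ) : qFact n ≠ 0 := by
  induction n with
  | zero => exact one_ne_zero
  | succ n ih =>
    refine mul_ne_zero (fun h => ?_) ih
    have h1 := sub_mul_qInt (n + 1)
    rw [h, mul_zero, eq_comm, sub_eq_zero] at h1
    have := qp_injective h1
    omega

theorem qBinom_self (n : ℕ) : qBinom n n = 1 := by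
  have h := qBinom_mul n 0
  rw [add_zero, show qFact 0 = 1 from rfl, mul_one] at h
  exact mul_right_cancel₀ (qFact_ne_zero n) (by rw [h, one_mul])

/-- The Pascal rule with the powers of `q` inverted. -/
theorem qBinom_succ_succ' (n k : ℕ) : qBinom (n + 1) (k + 1) =
    qp (-((k : ℤ) + 1)) * qBinom n (k + 1) + qp ((n : ℤ) - k) * qBinom n k := by
  rcases lt_trichotomy n k with h | rfl | h
  · rw [qBinom_eq_zero _ _ (by omega), qBinom_eq_zero _ _ (by omega), qBinom_eq_zero _ _ h]
    simp
  · rw [qBinom_self, qBinom_self, qBinom_eq_zero _ _ (by omega)]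
    simp [qp_zero]
  · obtain ⟨b, rfl⟩ : ∃ b, n = k + 1 + b := ⟨n - k - 1, by omega⟩
    apply mul_right_cancel₀ (mul_ne_zero (qFact_ne_zero (k + 1)) (qFact_ne_zero (b + 1)))
    have h1 := qBinom_mul (k + 1) b
    have h2 := qBinom_mul k (b + 1)
    have h0 := qBinom_mul (k + 1) (b + 1)
    have h3 := qInt_add (b + 1) (k + 1)
    rw [show k + (b + 1) = k + 1 + b by omega] at h2
    rw [show k + 1 + (b + 1) = k + 1 + b + 1 by omega] at h0
    rw [show b + 1 + (k + 1) = k + 1 + b + 1 by omega] at h3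
    have e0 : qFact (k + 1 + b + 1) = qInt (k + 1 + b + 1) * qFact (k + 1 + b) := rfl
    have eb : qFact (b + 1) = qInt (b + 1) * qFact b := rfl
    have ek : qFact (k + 1) = qInt (k + 1) * qFact k := rfl
    rw [h0, e0, h3]
    rw [eb] at h2 ⊢
    rw [ek] at h1 ⊢
    rw [show ((k + 1 + b : ℕ) : ℤ) - k = ((b + 1 : ℕ) : ℤ) by push_cast; ring,
      show (k : ℤ) + 1 = ((k + 1 : ℕ) : ℤ) by push_cast; ring]
    linear_combination -qp (-((k + 1 : ℕ) : ℤ)) * qInt (b + 1) * h1 -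
      qp ((b + 1 : ℕ) : ℤ) * qInt (k + 1) * h2

/-- Trinomial revision. -/
theorem qBinom_mul_qBinom (k m c : ℕ) : qBinom (k + m + c) (m + c) * qBinom (m + c) c =
    qBinom (k + m) m * qBinom (k + m + c) c := by
  have h1 := qBinom_mul (m + c) k
  have h2 := qBinom_mul c m
  have h3 := qBinom_mul m k
  have h4 := qBinom_mul c (k + m)
  rw [show m + c + k = k + m + c by omega] at h1
  rw [show c + m = m + c by omega] at h2
  rw [show m + k = k + m by omega] at h3
  rw [show c + (k + m) = k + m + c by omega] at h4
  apply mul_right_cancel₀ (mul_ne_zero (qFact_ne_zero c)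
    (mul_ne_zero (qFact_ne_zero m) (qFact_ne_zero k)))
  linear_combination qBinom (k + m + c) (m + c) * qFact k * h2 + h1 - h4 -
    qBinom (k + m + c) c * qFact c * h3

/-! ### Matrix coefficients of the divided powers and of the braiding -/

/-- The coefficient of `F^(m)`: `F^(m) v_j = coeffF m j • v_(j+m)`. -/
def coeffF (m j : ℕ) : LL := qBinom (m + j) j *
  ∏ k ∈ Finset.range m, (sp 1 * qp (-(k : ℤ) - j) - sp (-1) * qp ((k : ℤ) + j))

theorem coeffF_zero (j : ℕ) : coeffF 0 j = 1 := by simp [coeffF, qBinom_self]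

/-- `[E, F^(m+1)] = F^(m) (q^(-m) K - q^m K⁻¹)` on `v_0`. -/
theorem coeffF_succ_zero (m : ℕ) :
    coeffF (m + 1) 0 = coeffF m 0 * (sp 1 * qp (-(m : ℤ)) - sp (-1) * qp m) := by
  simp [coeffF, qBinom_zero_right, Finset.prod_range_succ]

/-- `[E, F^(m+1)] = F^(m) (q^(-m) K - q^m K⁻¹)` on `v_(j+1)`. -/
theorem coeffF_succ_succ (m j : ℕ) :
    coeffF (m + 1) (j + 1) - coeffF (m + 1) j = coeffF m (j + 1) *
      (sp 1 * qp (-2 * ((j : ℤ) + 1) - m) - sp (-1) * qp (2 * ((j : ℤ) + 1) + m)) := by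
  have hP : ∏ k ∈ Finset.range (m + 1), (sp 1 * qp (-(k : ℤ) - j) - sp (-1) * qp ((k : ℤ) + j)) =
      (∏ k ∈ Finset.range m, (sp 1 * qp (-(k : ℤ) - (j + 1 : ℕ)) -
        sp (-1) * qp ((k : ℤ) + (j + 1 : ℕ)))) *
        (sp 1 * qp (-(j : ℤ)) - sp (-1) * qp j) := by
    rw [Finset.prod_range_succ']
    refine congrArg₂ (· * ·) ?_ ?_
    · refine Finset.prod_congr rfl fun k _ => ?_
      rw [show -((k + 1 : ℕ) : ℤ) - j = -(k : ℤ) - (j + 1 : ℕ) by push_cast; ring,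
        show ((k + 1 : ℕ) : ℤ) + j = (k : ℤ) + (j + 1 : ℕ) by push_cast; ring]
    · rw [Nat.cast_zero, neg_zero, zero_sub, zero_add]
  rw [coeffF, coeffF, coeffF, hP, Finset.prod_range_succ]
  have h1 : qBinom (m + 1 + (j + 1)) (j + 1) =
      qp ((j : ℤ) + 1) * qBinom (m + (j + 1)) (j + 1) +
        qp (-((m : ℤ) + 1)) * qBinom (m + 1 + j) j := by
    rw [show m + 1 + (j + 1) = (m + 1 + j) + 1 by omega, qBinom]
    rw [show m + 1 + j = m + (j + 1) by omega]
    congr 3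
    push_cast; ring
  have h2 : qBinom (m + 1 + (j + 1)) (j + 1) =
      qp (-((j : ℤ) + 1)) * qBinom (m + (j + 1)) (j + 1) +
        qp ((m : ℤ) + 1) * qBinom (m + 1 + j) j := by
    rw [show m + 1 + (j + 1) = (m + 1 + j) + 1 by omega, qBinom_succ_succ']
    rw [show m + 1 + j = m + (j + 1) by omega]
    congr 3
    push_cast; ring
  set P := ∏ k ∈ Finset.range m, (sp 1 * qp (-(k : ℤ) - (j + 1 : ℕ)) -
        sp (-1) * qp ((k : ℤ) + (j + 1 : ℕ)))
  push_cast
  have e1 : qp (-2 * ((j : ℤ) + 1) - m) = qp (-(m : ℤ) - (j + 1)) * qp (-((j : ℤ) + 1)) := by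
    rw [← qp_add]; congr 1; ring
  have e2 : qp (2 * ((j : ℤ) + 1) + m) = qp ((m : ℤ) + (j + 1)) * qp ((j : ℤ) + 1) := by
    rw [← qp_add]; congr 1; ring
  have e3 : qp (-(j : ℤ)) = qp (-(m : ℤ) - (j + 1)) * qp ((m : ℤ) + 1) := by
    rw [← qp_add]; congr 1; ring
  have e4 : qp (j : ℤ) = qp ((m : ℤ) + (j + 1)) * qp (-((m : ℤ) + 1)) := by
    rw [← qp_add]; congr 1; ring
  rw [e1, e2, e3, e4]
  linear_combination P * sp 1 * qp (-(m : ℤ) - (j + 1)) * h2 -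
    P * sp (-1) * qp ((m : ℤ) + (j + 1)) * h1

/-- `F^(k) F^(m) = [k+m choose m] F^(k+m)`. -/
theorem coeffF_mul_coeffF (k m c : ℕ) :
    coeffF k (c + m) * coeffF m c = qBinom (k + m) m * coeffF (k + m) c := by
  have hP : ∏ x ∈ Finset.range (k + m), (sp 1 * qp (-(x : ℤ) - c) - sp (-1) * qp ((x : ℤ) + c)) =
      (∏ x ∈ Finset.range m, (sp 1 * qp (-(x : ℤ) - c) - sp (-1) * qp ((x : ℤ) + c))) *
      ∏ x ∈ Finset.range k, (sp 1 * qp (-(x : ℤ) - (c + m : ℕ)) -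
        sp (-1) * qp ((x : ℤ) + (c + m : ℕ))) := by
    rw [add_comm k m, Finset.prod_range_add]
    refine congrArg₂ (· * ·) rfl ?_
    refine Finset.prod_congr rfl fun x _ => ?_
    rw [show -((m + x : ℕ) : ℤ) - c = -(x : ℤ) - (c + m : ℕ) by push_cast; ring,
      show ((m + x : ℕ) : ℤ) + c = (x : ℤ) + (c + m : ℕ) by push_cast; ring]
  have h := qBinom_mul_qBinom k m c
  rw [coeffF, coeffF, coeffF, hP]
  rw [show k + (c + m) = k + m + c by omega]
  rw [show qBinom (k + m + c) (c + m) = qBinom (k + m + c) (m + c) by rw [add_comm c m]]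
  generalize (∏ x ∈ Finset.range k, (sp 1 * qp (-(x : ℤ) - (c + m : ℕ)) -
        sp (-1) * qp ((x : ℤ) + (c + m : ℕ)))) = A
  generalize (∏ x ∈ Finset.range m, (sp 1 * qp (-(x : ℤ) - c) - sp (-1) * qp ((x : ℤ) + c))) = B
  linear_combination A * B * h

/-- The triangular number `m(m-1)/2`, the exponent in the quasi-`R`-matrix. -/
def tri (m : ℕ) : ℤ := ((m * (m - 1) / 2 : ℕ) : ℤ)

theorem tri_zero : tri 0 = 0 := rfl

theorem tri_succ (m : ℕ) : tri (m + 1) = tri m + m := by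
  rw [tri, tri, Nat.triangle_succ]; push_cast; rfl

theorem tri_add (k m : ℕ) : tri (k + m) = tri k + tri m + k * m := by
  induction m with
  | zero => simp [tri_zero]
  | succ m ih => rw [← add_assoc, tri_succ, tri_succ, ih]; push_cast; ring

/-- The coefficient of `v_(j+m) ⊗ v_(i-m)` in `R (v_i ⊗ v_j)`, for `m ≤ i`. -/
def coeffR (i j m : ℕ) : LL :=
  sp (-((i : ℤ) + j)) * qp (2 * ((i : ℤ) - m) * (j + m)) * qp (tri m) * coeffF m j

theorem vBasis_apply (j : ℕ) : vBasis j = v j := by simp [vBasis, v]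

theorem vvBasis_apply (p : ℕ × ℕ) : vvBasis p = v p.1 ⊗ₜ[LL] v p.2 := by
  rw [vvBasis, Module.Basis.tensorProduct_apply, vBasis_apply, vBasis_apply]

theorem K_v (j : ℕ) : K (v j) = (sp 1 * qp (-2 * j)) • v j := by
  rw [← vBasis_apply, K, Module.Basis.constr_basis, vBasis_apply]

theorem E_v (j : ℕ) : E (v j) = if j = 0 then 0 else v (j - 1) := by
  rw [E, ← vBasis_apply, Module.Basis.constr_basis]

theorem E_pow_v (m j : ℕ) : (E ^ m) (v j) = if m ≤ j then v (j - m) else 0 := by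
  induction m generalizing j with
  | zero => simp
  | succ m ih =>
    rw [pow_succ, Module.End.mul_apply, E_v]
    split_ifs with h h' h'
    · omega
    · simp
    · rw [ih, if_pos (by omega)]; congr 1; omega
    · rw [ih, if_neg (by omega)]

theorem F_v (m j : ℕ) : F m (v j) = coeffF m j • v (j + m) := by
  rw [F, ← vBasis_apply, Module.Basis.constr_basis]; rfl

theorem R_v_tmul_v (i j : ℕ) : R (v i ⊗ₜ[LL] v j) =
    ∑ m ∈ Finset.range (i + 1), coeffR i j m • (v (j + m) ⊗ₜ[LL] v (i - m)) := by
  have hP : Pmap (v i ⊗ₜ[LL] v j) = ∑ m ∈ Finset.range (i + 1),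
      qp (tri m) • (((E ^ m) (v i)) ⊗ₜ[LL] (F m (v j))) := by
    have := vvBasis_apply (i, j)
    dsimp only at this
    rw [← this, Pmap, Module.Basis.constr_basis]
    rfl
  have hC : ∀ a b, Cmap (v a ⊗ₜ[LL] v b) =
      (sp (-((a : ℤ) + b)) * qp (2 * a * b)) • (v a ⊗ₜ[LL] v b) := by
    intro a b
    have := vvBasis_apply (a, b)
    dsimp only at this
    rw [← this, Cmap, Module.Basis.constr_basis, this]
  rw [R, LinearMap.comp_apply, LinearMap.comp_apply, hP, map_sum, map_sum]
  refine Finset.sum_congr rfl fun m hm => ?_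
  have hm' : m ≤ i := by simpa [Nat.lt_succ_iff] using hm
  rw [E_pow_v, if_pos hm', F_v, TensorProduct.tmul_smul, map_smul, map_smul, map_smul, map_smul, hC,
    map_smul, LinearEquiv.coe_coe, TensorProduct.comm_tmul, smul_smul, smul_smul]
  have e1 : (-(((i - m : ℕ) : ℤ) + (j + m : ℕ))) = -((i : ℤ) + j) := by
    rw [Nat.cast_sub hm']; push_cast; ring
  have e2 : (2 * ((i - m : ℕ) : ℤ) * (j + m : ℕ)) = 2 * ((i : ℤ) - m) * (j + m) := by
    rw [Nat.cast_sub hm']; push_cast; ring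
  rw [e1, e2, coeffR]
  refine congrArg (· • _) ?_
  ring

/-! ### The operators `K` and `E` on the basis of `V^{⊗ n}` -/

theorem prod_weight {n : ℕ} (β : Fin n → ℕ) :
    ∏ i, (sp 1 * qp (-2 * (β i : ℤ))) = sp n * qp (-2 * (∑ i, β i : ℕ)) := by
  rw [Finset.prod_mul_distrib, Finset.prod_const, Finset.card_univ, Fintype.card_fin,
    ← sp_natCast]
  refine congrArg _ ?_
  induction (Finset.univ : Finset (Fin n)) using Finset.induction_on with
  | empty => simp [qp_zero]
  | insert a s ha ih =>
    rw [Finset.prod_insert ha, Finset.sum_insert ha, ih, ← qp_add]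
    refine congrArg qp ?_
    push_cast; ring

theorem Kn_vt {n : ℕ} (β : Fin n → ℕ) :
    Kn n (vt β) = (sp n * qp (-2 * (∑ i, β i : ℕ))) • vt β := by
  rw [← prod_weight, vt, Kn, PiTensorProduct.map_tprod, ← MultilinearMap.map_smul_univ]
  exact congrArg _ (funext fun i => K_v _)

/-- The eigenvalue on `v_β` of the factors `K` to the right of position `i`. -/
def weightAfter {n : ℕ} (β : Fin n → ℕ) (i : Fin n) : LL :=
  ∏ j, if i < j then sp 1 * qp (-2 * (β j : ℤ)) else 1

theorem isUnit_weightAfter {n : ℕ} (β : Fin n → ℕ) (i : Fin n) : IsUnit (weightAfter β i) := by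
  refine IsUnit.prod_univ_iff.2 fun j => ?_
  split_ifs
  · exact (isUnit_sp _).mul (isUnit_qp _)
  · exact isUnit_one

/-- The `i`-th summand of `E v_β`. -/
def lowerTerm {n : ℕ} (β : Fin n → ℕ) (i : Fin n) : Vpow n :=
  if β i = 0 then 0 else weightAfter β i • vt (Function.update β i (β i - 1))

theorem map_lower_vt {n : ℕ} (β : Fin n → ℕ) (i : Fin n) :
    PiTensorProduct.map (R := LL) (s := fun _ : Fin n => V) (t := fun _ => V)
      (fun j => (if j < i then LinearMap.id else if j = i then E else K : V →ₗ[LL] V)) (vt β) =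
      lowerTerm β i := by
  rw [lowerTerm, vt, PiTensorProduct.map_tprod]
  split_ifs with h
  · refine MultilinearMap.map_coord_zero _ i ?_
    simp [E_v, h]
  · rw [vt, weightAfter, ← MultilinearMap.map_smul_univ]
    refine congrArg _ (funext fun j => ?_)
    rcases lt_trichotomy j i with hj | rfl | hj
    · simp [hj, hj.ne, not_lt.2 hj.le]
    · simp [E_v, h]
    · simp [hj, hj.ne', not_lt.2 hj.le, K_v]

theorem En_vt {n : ℕ} (β : Fin n → ℕ) : En n (vt β) = ∑ i, lowerTerm β i := by
  rw [En, LinearMap.sum_apply]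
  exact Finset.sum_congr rfl fun i _ => map_lower_vt β i

theorem sum_update_sub_one {n : ℕ} (β : Fin n → ℕ) (i : Fin n) (h : β i ≠ 0) :
    ∑ j, Function.update β i (β i - 1) j + 1 = ∑ j, β j := by
  rw [Finset.sum_update_of_mem (Finset.mem_univ _),
    ← Finset.add_sum_erase _ _ (Finset.mem_univ i), Finset.sdiff_singleton_eq_erase]
  omega

/-! ### Weight spaces -/

theorem weightSpace_eq_span (n l : ℕ) :
    weightSpace n l = Submodule.span LL (vt '' {β : Fin n → ℕ | ∑ i, β i = l}) := by
  apply le_antisymm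
  · intro x hx
    have himg : (vt '' {β : Fin n → ℕ | ∑ i, β i = l}) =
        vpBasis n '' {β : Fin n → ℕ | ∑ i, β i = l} :=
      Set.image_congr fun β _ => (vpBasis_apply β).symm
    rw [himg, Module.Basis.mem_span_image]
    intro β hβ
    have hx' : Kn n x = (sp n * qp (-2 * l)) • x := by
      rw [weightSpace, LinearMap.mem_ker, LinearMap.sub_apply, sub_eq_zero] at hx
      simpa using hx
    have hK : (vpBasis n).coord β ∘ₗ Kn n =
        (sp n * qp (-2 * (∑ i, β i : ℕ))) • (vpBasis n).coord β := by
      refine (vpBasis n).ext fun γ => ?_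
      rw [LinearMap.comp_apply, vpBasis_apply, Kn_vt, map_smul, LinearMap.smul_apply,
        ← vpBasis_apply, Module.Basis.coord_apply, Module.Basis.repr_self]
      by_cases h : γ = β
      · rw [h]
      · simp [h]
    have h1 := LinearMap.congr_fun hK x
    rw [LinearMap.comp_apply, hx', map_smul, LinearMap.smul_apply, smul_eq_mul, smul_eq_mul] at h1
    have h2 : (vpBasis n).coord β x ≠ 0 := by simpa using hβ
    have h3 := qp_injective ((isUnit_sp _).mul_left_cancel (mul_right_cancel₀ h2 h1))
    have : ((∑ i, β i : ℕ) : ℤ) = l := by linarith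
    exact_mod_cast this
  · rw [Submodule.span_le]
    rintro _ ⟨β, rfl, rfl⟩
    simp [weightSpace, Kn_vt]

theorem vt_mem_weightSpace {n l : ℕ} {β : Fin n → ℕ} (h : ∑ i, β i = l) :
    vt β ∈ weightSpace n l := by
  rw [weightSpace_eq_span]
  exact Submodule.subset_span ⟨β, h, rfl⟩

theorem Kn_of_mem {n l : ℕ} {x : Vpow n} (hx : x ∈ weightSpace n l) :
    Kn n x = (sp n * qp (-2 * l)) • x := by
  rw [weightSpace, LinearMap.mem_ker, LinearMap.sub_apply, sub_eq_zero] at hx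
  simpa using hx

/-- A linear map sends `V_{n,l}` into a submodule as soon as it does so on the basis vectors. -/
theorem map_mem_of_vt {n l : ℕ} {M : Type*} [AddCommMonoid M] [Module LL M]
    (f : Vpow n →ₗ[LL] M) (N : Submodule LL M)
    (h : ∀ β : Fin n → ℕ, ∑ i, β i = l → f (vt β) ∈ N) {x : Vpow n}
    (hx : x ∈ weightSpace n l) : f x ∈ N := by
  have hle : weightSpace n l ≤ N.comap f := by
    rw [weightSpace_eq_span, Submodule.span_le]
    rintro _ ⟨β, hβ, rfl⟩
    exact h β hβ
  exact hle hx

/-- In degree `0`, where `l - 1 = 0`, the image is zero. -/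
theorem En_mem {n l : ℕ} {x : Vpow n} (hx : x ∈ weightSpace n l) :
    En n x ∈ weightSpace n (l - 1) := by
  refine map_mem_of_vt (En n) _ (fun β hβ => ?_) hx
  rw [En_vt]
  refine Submodule.sum_mem _ fun i _ => ?_
  rw [lowerTerm]
  split_ifs with h
  · exact Submodule.zero_mem _
  · refine Submodule.smul_mem _ _ (vt_mem_weightSpace ?_)
    have := sum_update_sub_one β i h
    omega

theorem En_pow_mem {n l : ℕ} {x : Vpow n} (hx : x ∈ weightSpace n l) (k : ℕ) :
    (En n ^ k) x ∈ weightSpace n (l - k) := by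
  induction k with
  | zero => simpa using hx
  | succ k ih =>
    rw [pow_succ', Module.End.mul_apply]
    exact En_mem ih

theorem En_eq_zero {n : ℕ} {x : Vpow n} (hx : x ∈ weightSpace n 0) : En n x = 0 := by
  refine map_mem_of_vt (En n) ⊥ (fun β hβ => ?_) hx
  rw [En_vt, Submodule.mem_bot]
  refine Finset.sum_eq_zero fun i _ => ?_
  rw [lowerTerm, if_pos]
  exact (Finset.sum_eq_zero_iff.1 hβ) i (Finset.mem_univ _)

instance finite_weightSpace (n l : ℕ) : Module.Finite LL (weightSpace n l) := by
  rw [weightSpace_eq_span]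
  refine Module.Finite.span_of_finite LL (Set.Finite.image _ ?_)
  refine (Set.Finite.pi' (fun _ : Fin n => Set.finite_Iic l)).subset fun β hβ i => ?_
  exact (Finset.single_le_sum (f := β) (fun _ _ => Nat.zero_le _) (Finset.mem_univ i)).trans
    (le_of_eq hβ)

/-! ### Inverting `E` on the span of `ℬ` -/

theorem exists_leading {n : ℕ} (hn : 1 ≤ n) (γ : Fin n → ℕ) :
    ∃ k : Fin n, (∀ j < k, γ j = 0) ∧ (γ k ≠ 0 ∨ (k : ℕ) + 1 = n) := by
  by_cases h : ∃ k, γ k ≠ 0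
  · obtain ⟨k, hk, hmin⟩ := WellFounded.has_min (wellFounded_lt (α := Fin n)) {k | γ k ≠ 0} h
    exact ⟨k, fun j hj => by_contra fun h' => hmin j h' hj, Or.inl hk⟩
  · push Not at h
    exact ⟨⟨n - 1, by omega⟩, fun j _ => h j, Or.inr (by simp; omega)⟩

open Classical in
/-- Increase the first nonzero entry of `γ` by one; if `γ = 0`, increase the last entry. -/
def raise {n : ℕ} (γ : Fin n → ℕ) : Fin n → ℕ :=
  if h : 1 ≤ n then
    Function.update γ (exists_leading h γ).choose (γ (exists_leading h γ).choose + 1)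
  else γ

theorem raise_spec {n : ℕ} (hn : 1 ≤ n) (γ : Fin n → ℕ) :
    ∃ k : Fin n, (∀ j < k, γ j = 0) ∧ (γ k ≠ 0 ∨ (k : ℕ) + 1 = n) ∧
      raise γ = Function.update γ k (γ k + 1) := by
  have h := (exists_leading hn γ).choose_spec
  exact ⟨_, h.1, h.2, by rw [raise, dif_pos hn]⟩

theorem sum_update_add_one {n : ℕ} (γ : Fin n → ℕ) (k : Fin n) :
    ∑ j, Function.update γ k (γ k + 1) j = ∑ j, γ j + 1 := by
  rw [Finset.sum_update_of_mem (Finset.mem_univ _),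
    ← Finset.add_sum_erase Finset.univ γ (Finset.mem_univ k), Finset.sdiff_singleton_eq_erase]
  omega

theorem sum_raise {n : ℕ} (hn : 1 ≤ n) (γ : Fin n → ℕ) : ∑ j, raise γ j = ∑ j, γ j + 1 := by
  obtain ⟨k, -, -, h⟩ := raise_spec hn γ
  rw [h, sum_update_add_one]

theorem isB_raise {n : ℕ} (hn : 1 ≤ n) (γ : Fin n → ℕ) : IsB (raise γ) := by
  obtain ⟨k, h0, h1, h⟩ := raise_spec hn γ
  refine ⟨k, fun j hj => by rw [h, Function.update_of_ne hj.ne, h0 j hj], ?_⟩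
  rw [h, Function.update_self]
  omega

theorem exists_raise_eq {n : ℕ} {β : Fin n → ℕ} (hβ : IsB β) : ∃ γ, raise γ = β := by
  obtain ⟨k, h0, h1⟩ := hβ
  have hn : 1 ≤ n := by have := k.2; omega
  refine ⟨Function.update β k (β k - 1), ?_⟩
  obtain ⟨k', h0', h1', h⟩ := raise_spec hn (Function.update β k (β k - 1))
  have hk : k' = k := by
    rcases lt_trichotomy k' k with hlt | heq | hlt
    · rw [Function.update_of_ne hlt.ne, h0 _ hlt] at h1'
      have : (k' : ℕ) < k := hlt
      omega
    · exact heq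
    · have := h0' k hlt
      rw [Function.update_self] at this
      have : (k : ℕ) < k' := hlt
      omega
  rw [h, hk, Function.update_self, Function.update_idem]
  conv_rhs => rw [← Function.update_eq_self k β]
  refine congrArg _ ?_
  omega

/-- The linear map `v_γ ↦ v_(raise γ)`. -/
def raiseMap (n : ℕ) : Vpow n →ₗ[LL] Vpow n := (vpBasis n).constr LL fun γ => vt (raise γ)

theorem raiseMap_vt {n : ℕ} (γ : Fin n → ℕ) : raiseMap n (vt γ) = vt (raise γ) := by
  rw [← vpBasis_apply, raiseMap, Module.Basis.constr_basis]

theorem map_raiseMap_weightSpace {n : ℕ} (hn : 1 ≤ n) (k : ℕ) :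
    (weightSpace n k).map (raiseMap n) = spanB n (k + 1) := by
  rw [weightSpace_eq_span, Submodule.map_span, spanB]
  refine congrArg _ (Set.ext fun x => ⟨?_, ?_⟩)
  · rintro ⟨_, ⟨γ, hγ, rfl⟩, rfl⟩
    exact ⟨raise γ, ⟨by rw [sum_raise hn, hγ], isB_raise hn γ⟩, (raiseMap_vt γ).symm⟩
  · rintro ⟨β, ⟨hs, hB⟩, rfl⟩
    obtain ⟨γ, rfl⟩ := exists_raise_eq hB
    rw [sum_raise hn] at hs
    exact ⟨vt γ, ⟨γ, Nat.succ_injective hs, rfl⟩, raiseMap_vt γ⟩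

theorem spanB_le_weightSpace (n l : ℕ) : spanB n l ≤ weightSpace n l := by
  rw [spanB, Submodule.span_le]
  rintro _ ⟨β, ⟨hβ, -⟩, rfl⟩
  exact vt_mem_weightSpace hβ

/-- Triangularity of `E`: the leading term of `E v_(raise γ)` is `v_γ`, and all its other terms
are `v_δ` with a smaller value of `∑ i, i δ_i`. -/
theorem vt_mem_map_En {n : ℕ} (hn : 1 ≤ n) (k : ℕ) (γ : Fin n → ℕ) (hγ : ∑ i, γ i = k) :
    vt γ ∈ (weightSpace n k).map (En n ∘ₗ raiseMap n) := by
  obtain ⟨N, hN⟩ : ∃ N, N = ∑ i : Fin n, (i : ℕ) * γ i := ⟨_, rfl⟩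
  induction N using Nat.strong_induction_on generalizing γ with
  | _ N ih =>
    obtain ⟨f, h0, h1, h⟩ := raise_spec hn γ
    have hE : En n (raiseMap n (vt γ)) = weightAfter (raise γ) f • vt γ +
        ∑ i ∈ Finset.univ.erase f, lowerTerm (raise γ) i := by
      rw [raiseMap_vt, En_vt, ← Finset.add_sum_erase _ _ (Finset.mem_univ f)]
      refine congrArg (· + _) ?_
      have hf : raise γ f = γ f + 1 := by rw [h, Function.update_self]
      rw [lowerTerm, hf, if_neg (Nat.succ_ne_zero _), h, Function.update_idem]
      simp
    have hrest : ∑ i ∈ Finset.univ.erase f, lowerTerm (raise γ) i ∈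
        (weightSpace n k).map (En n ∘ₗ raiseMap n) := by
      refine Submodule.sum_mem _ fun i hi => ?_
      have hif : i ≠ f := Finset.ne_of_mem_erase hi
      rw [lowerTerm]
      split_ifs with hz
      · exact Submodule.zero_mem _
      · refine Submodule.smul_mem _ _ (ih _ ?_ _ ?_ rfl)
        · have hri : raise γ i = γ i := by rw [h, Function.update_of_ne hif]
          rw [hri] at hz
          have hlt : f < i := lt_of_le_of_ne (not_lt.1 fun hlt => hz (h0 i hlt)) hif.symm
          have hlt' : (f : ℕ) < i := hlt
          rw [hN, hri, h]
          rw [← Finset.add_sum_erase _ _ (Finset.mem_univ i),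
            ← Finset.add_sum_erase (Finset.univ.erase i) _
              (Finset.mem_erase.2 ⟨hif.symm, Finset.mem_univ f⟩),
            ← Finset.add_sum_erase _ (fun i : Fin n => (i : ℕ) * γ i) (Finset.mem_univ i),
            ← Finset.add_sum_erase (Finset.univ.erase i) (fun i : Fin n => (i : ℕ) * γ i)
              (Finset.mem_erase.2 ⟨hif.symm, Finset.mem_univ f⟩)]
          have hrest : ∑ x ∈ (Finset.univ.erase i).erase f, (x : ℕ) *
              Function.update (Function.update γ f (γ f + 1)) i (γ i - 1) x =
              ∑ x ∈ (Finset.univ.erase i).erase f, (x : ℕ) * γ x := by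
            refine Finset.sum_congr rfl fun x hx => ?_
            rw [Finset.mem_erase, Finset.mem_erase] at hx
            rw [Function.update_of_ne hx.2.1, Function.update_of_ne hx.1]
          rw [hrest, Function.update_self, Function.update_of_ne hif.symm, Function.update_self]
          obtain ⟨c, hc⟩ := Nat.exists_eq_succ_of_ne_zero hz
          rw [hc, Nat.succ_sub_one, Nat.mul_succ, Nat.mul_succ]
          omega
        · have := sum_update_sub_one (raise γ) i hz
          rw [sum_raise hn] at this
          omega
    have hmem : En n (raiseMap n (vt γ)) ∈ (weightSpace n k).map (En n ∘ₗ raiseMap n) :=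
      ⟨vt γ, vt_mem_weightSpace hγ, rfl⟩
    have hlead : weightAfter (raise γ) f • vt γ ∈ (weightSpace n k).map (En n ∘ₗ raiseMap n) := by
      have := Submodule.sub_mem _ hmem hrest
      rwa [hE, add_sub_cancel_right] at this
    obtain ⟨u, hu⟩ := isUnit_weightAfter (raise γ) f
    rw [← hu] at hlead
    have := Submodule.smul_mem _ ((u⁻¹ : LLˣ) : LL) hlead
    rwa [smul_smul, Units.inv_mul, one_smul] at this

theorem En_raiseMap_mem {n : ℕ} (hn : 1 ≤ n) {k : ℕ} {x : Vpow n} (hx : x ∈ weightSpace n k) :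
    (En n ∘ₗ raiseMap n) x ∈ weightSpace n k := by
  have h : raiseMap n x ∈ spanB n (k + 1) := by
    rw [← map_raiseMap_weightSpace hn]; exact Submodule.mem_map_of_mem hx
  have h' := En_mem (spanB_le_weightSpace _ _ h)
  rwa [Nat.add_sub_cancel, ← LinearMap.comp_apply] at h'

/-- `v_γ ↦ E v_(raise γ)` as an endomorphism of `V_{n,k}`. -/
def raiseLower {n : ℕ} (hn : 1 ≤ n) (k : ℕ) : weightSpace n k →ₗ[LL] weightSpace n k :=
  (En n ∘ₗ raiseMap n).restrict fun _ hx => En_raiseMap_mem hn hx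

/-- Surjectivity is triangularity; injectivity follows since `V_{n,k}` is finitely generated over
a commutative ring. -/
theorem raiseLower_bijective {n : ℕ} (hn : 1 ≤ n) (k : ℕ) :
    Function.Bijective (raiseLower hn k) := by
  refine OrzechProperty.bijective_of_surjective_endomorphism _ ?_
  rintro ⟨y, hy⟩
  have hle : weightSpace n k ≤ (weightSpace n k).map (En n ∘ₗ raiseMap n) := by
    conv_lhs => rw [weightSpace_eq_span]
    rw [Submodule.span_le]
    rintro _ ⟨β, hβ, rfl⟩
    exact vt_mem_map_En hn k β hβ
  obtain ⟨x, hx, hxy⟩ := hle hy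
  exact ⟨⟨x, hx⟩, Subtype.ext hxy⟩

theorem existsUnique_En_eq {n : ℕ} (hn : 1 ≤ n) (k : ℕ) {x : Vpow n}
    (hx : x ∈ weightSpace n k) : ∃! η : Vpow n, η ∈ spanB n (k + 1) ∧ En n η = x := by
  obtain ⟨⟨z, hz⟩, hzx⟩ := (raiseLower_bijective hn k).2 ⟨x, hx⟩
  have hzx' : En n (raiseMap n z) = x := congrArg Subtype.val hzx
  refine ⟨raiseMap n z, ⟨?_, hzx'⟩, ?_⟩
  · rw [← map_raiseMap_weightSpace hn]; exact Submodule.mem_map_of_mem hz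
  · rintro η ⟨hη, hηx⟩
    rw [← map_raiseMap_weightSpace hn] at hη
    obtain ⟨y, hy, rfl⟩ := hη
    have : (⟨y, hy⟩ : weightSpace n k) = ⟨z, hz⟩ :=
      (raiseLower_bijective hn k).1 (Subtype.ext (hηx.trans hzx'.symm))
    rw [Subtype.mk.inj this]

theorem eq_zero_of_mem_spanB {n l : ℕ} (hn : 1 ≤ n) {x : Vpow n} (hx : x ∈ spanB n (l + 1))
    (h : En n x = 0) : x = 0 :=
  (existsUnique_En_eq hn l (Submodule.zero_mem _)).unique ⟨hx, h⟩
    ⟨Submodule.zero_mem _, map_zero _⟩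

theorem raise_injective {n : ℕ} (hn : 1 ≤ n) : Function.Injective (raise (n := n)) := by
  intro γ γ' h
  have hs : ∑ i, γ' i = ∑ i, γ i := by
    have := congrArg (fun β : Fin n → ℕ => ∑ i, β i) h
    simp only [sum_raise hn] at this
    omega
  have := (raiseLower_bijective hn (∑ i, γ i)).1
    (a₁ := ⟨vt γ, vt_mem_weightSpace rfl⟩) (a₂ := ⟨vt γ', vt_mem_weightSpace hs⟩)
    (Subtype.ext (by
      change En n (raiseMap n (vt γ)) = En n (raiseMap n (vt γ'))
      rw [raiseMap_vt, raiseMap_vt, h]))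
  have h' : vt γ = vt γ' := Subtype.mk.inj this
  rw [← vpBasis_apply, ← vpBasis_apply] at h'
  exact (vpBasis n).injective h'

/-! ### Splitting off the first tensor factors -/

@[to_additive]
theorem prod_eq_prod_mul_prod {M : Type*} [CommMonoid M] {n p : ℕ} (hp : p < n) (g : Fin n → M) :
    ∏ i, g i = (∏ i : Fin p, g ⟨i, by omega⟩) * g ⟨p, hp⟩ *
      ∏ i : Fin (n - p - 1), g ⟨p + 1 + i, by omega⟩ := by
  have h : p + 1 + (n - p - 1) = n := by omega
  rw [← (finCongr h).prod_comp, Fin.prod_univ_add, Fin.prod_univ_castSucc]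
  rfl

theorem pad_lt {n p k : ℕ} (α : Fin (n - p - 1) → ℕ) {i : Fin n} (h : (i : ℕ) < p) :
    pad p k α i = 0 := by
  rw [pad, dif_neg (by omega), if_neg (by omega)]

theorem pad_self {n p k : ℕ} (hp : p < n) (α : Fin (n - p - 1) → ℕ) :
    pad p k α ⟨p, hp⟩ = k := by
  simp [pad]

theorem pad_tail {n p k : ℕ} (α : Fin (n - p - 1) → ℕ) (i : Fin (n - p - 1)) :
    pad p k α (⟨p + 1 + i, by omega⟩ : Fin n) = α i := by
  rw [pad, dif_pos (by simp; omega)]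
  congr 1
  ext
  simp
  omega

theorem sum_pad {n p : ℕ} (hp : p < n) (k : ℕ) (α : Fin (n - p - 1) → ℕ) :
    ∑ i : Fin n, pad p k α i = k + ∑ i, α i := by
  rw [sum_eq_sum_add_sum hp, pad_self hp, Finset.sum_congr rfl fun i _ => pad_tail α i,
    Finset.sum_eq_zero fun i _ => pad_lt α i.2, zero_add]

theorem eq_pad {n p : ℕ} (hp : p < n) (β : Fin n → ℕ) (h : ∀ j : Fin n, (j : ℕ) < p → β j = 0) :
    β = pad p (β ⟨p, hp⟩) (fun i => β ⟨p + 1 + i, by omega⟩) := by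
  funext i
  rcases lt_trichotomy (i : ℕ) p with hi | hi | hi
  · rw [pad_lt _ hi, h i hi]
  · obtain rfl : i = ⟨p, hp⟩ := Fin.ext hi
    rw [pad_self]
  · rw [pad, dif_pos hi]
    congr 1
    ext
    simp
    omega

theorem update_pad_self {n p k : ℕ} (hp : p < n) (α : Fin (n - p - 1) → ℕ) (x : ℕ) :
    Function.update (pad p k α) ⟨p, hp⟩ x = pad p x α := by
  funext i
  by_cases hi : i = ⟨p, hp⟩
  · subst hi; rw [Function.update_self, pad_self]
  · rw [Function.update_of_ne hi, pad, pad]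
    have : (i : ℕ) ≠ p := fun h => hi (Fin.ext h)
    simp [this]

theorem update_pad_tail {n p k : ℕ} (α : Fin (n - p - 1) → ℕ) (i : Fin (n - p - 1)) (x : ℕ) :
    Function.update (pad p k α) (⟨p + 1 + i, by omega⟩ : Fin n) x =
      pad p k (Function.update α i x) := by
  funext j
  by_cases hj : j = ⟨p + 1 + i, by omega⟩
  · subst hj; rw [Function.update_self, pad_tail, Function.update_self]
  · rw [Function.update_of_ne hj, pad, pad]
    split_ifs with h
    · rw [Function.update_of_ne]
      rintro rfl
      apply hj
      ext
      simp
      omega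
    · rfl
    · rfl

theorem prepend_vt {n p k : ℕ} (α : Fin (n - p - 1) → ℕ) :
    prepend n p k (vt α) = vt (pad p k α) := by
  rw [← vpBasis_apply, prepend, Module.Basis.constr_basis]

theorem lowerTerm_pad_tail {n p k : ℕ} (hp : p < n) (α : Fin (n - p - 1) → ℕ)
    (i : Fin (n - p - 1)) : lowerTerm (pad p k α) (⟨p + 1 + i, by omega⟩ : Fin n) =
      prepend n p k (lowerTerm α i) := by
  have hw : weightAfter (pad p k α) (⟨p + 1 + i, by omega⟩ : Fin n) = weightAfter α i := by
    rw [weightAfter, prod_eq_prod_mul_prod hp, if_neg (by simp only [Fin.lt_def]; omega),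
      Finset.prod_eq_one fun j _ => if_neg (by simp only [Fin.lt_def]; omega), one_mul, one_mul]
    refine Finset.prod_congr rfl fun j _ => ?_
    rw [pad_tail]
    refine if_congr ?_ rfl rfl
    simp only [Fin.lt_def]
    omega
  rw [lowerTerm, lowerTerm, pad_tail, hw, update_pad_tail]
  split_ifs
  · rw [map_zero]
  · rw [map_smul, prepend_vt]

theorem lowerTerm_pad_self {n p k : ℕ} (hp : p < n) (α : Fin (n - p - 1) → ℕ) :
    lowerTerm (pad p k α) ⟨p, hp⟩ =
      if k = 0 then 0 else prepend n p (k - 1) (Kn (n - p - 1) (vt α)) := by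
  have hw : weightAfter (pad p k α) ⟨p, hp⟩ =
      sp (n - p - 1 : ℕ) * qp (-2 * (∑ i, α i : ℕ)) := by
    rw [weightAfter, prod_eq_prod_mul_prod hp, if_neg (lt_irrefl _),
      Finset.prod_eq_one fun j _ => if_neg (by simp only [Fin.lt_def]; omega), one_mul, one_mul,
      ← prod_weight]
    refine Finset.prod_congr rfl fun j _ => ?_
    rw [pad_tail, if_pos (by simp only [Fin.lt_def]; omega)]
  rw [lowerTerm, pad_self, hw, update_pad_self, Kn_vt]
  split_ifs
  · rfl
  · rw [map_smul, prepend_vt]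

/-- The coproduct `ΔE = E ⊗ K + 1 ⊗ E` on `v_0^{⊗ p} ⊗ v_k ⊗ y`. -/
theorem En_prepend {n p : ℕ} (hp : p < n) (k : ℕ) (y : Vpow (n - p - 1)) :
    En n (prepend n p k y) = (if k = 0 then 0 else prepend n p (k - 1) (Kn (n - p - 1) y)) +
      prepend n p k (En (n - p - 1) y) := by
  have h : En n ∘ₗ prepend n p k =
      (if k = 0 then 0 else prepend n p (k - 1) ∘ₗ Kn (n - p - 1)) +
        prepend n p k ∘ₗ En (n - p - 1) := by
    refine (vpBasis _).ext fun α => ?_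
    rw [vpBasis_apply, LinearMap.comp_apply, LinearMap.add_apply, LinearMap.comp_apply,
      prepend_vt, En_vt, En_vt, sum_eq_sum_add_sum hp, map_sum,
      Finset.sum_congr rfl fun i _ => lowerTerm_pad_tail hp α i, lowerTerm_pad_self,
      Finset.sum_eq_zero fun i _ => ?_, zero_add]
    · split_ifs <;> rfl
    · rw [lowerTerm, if_pos (pad_lt α i.2)]
  have := LinearMap.congr_fun h y
  rw [LinearMap.comp_apply, LinearMap.add_apply, LinearMap.comp_apply] at this
  rw [this]
  split_ifs <;> rfl

theorem prepend_mem_spanB_of_two_le {n p : ℕ} (hp : p < n) {k : ℕ} (hk : 2 ≤ k) {e : ℕ}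
    {y : Vpow (n - p - 1)} (hy : y ∈ weightSpace (n - p - 1) e) :
    prepend n p k y ∈ spanB n (k + e) :=
  map_mem_of_vt _ _ (fun α hα => by
    rw [prepend_vt]
    refine Submodule.subset_span ⟨_, ⟨by rw [sum_pad hp, hα], ⟨p, hp⟩, fun j hj => ?_, ?_⟩, rfl⟩
    · exact pad_lt α hj
    · rw [pad_self]; omega) hy

theorem prepend_zero_mem_spanB {n p : ℕ} (hp : p < n) {e : ℕ} {y : Vpow (n - p - 1)}
    (hy : y ∈ spanB (n - p - 1) e) : prepend n p 0 y ∈ spanB n e := by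
  have hle : spanB (n - p - 1) e ≤ (spanB n e).comap (prepend n p 0) := by
    rw [spanB, Submodule.span_le]
    rintro _ ⟨α, ⟨hα, k, h0, h1⟩, rfl⟩
    rw [SetLike.mem_coe, Submodule.mem_comap, prepend_vt]
    refine Submodule.subset_span ⟨_, ⟨by rw [sum_pad hp, hα, zero_add],
      ⟨p + 1 + k, by omega⟩, fun j hj => ?_, ?_⟩, rfl⟩
    · rcases lt_trichotomy (j : ℕ) p with hj' | hj' | hj'
      · exact pad_lt α hj'
      · obtain rfl : j = ⟨p, hp⟩ := Fin.ext hj'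
        rw [pad_self]
      · rw [pad, dif_pos hj']
        rw [Fin.lt_def] at hj
        exact h0 _ (by simp only [Fin.lt_def] at hj ⊢; omega)
    · rw [pad_tail]
      dsimp only
      omega
  exact hle hy

/-! ### The vectors `Φ (a)` -/

theorem Epow_zero_spec {m : ℕ} (hm : 1 ≤ m) (α : Fin m → ℕ) :
    Epow α 0 ∈ spanB m ((∑ i, α i) + 1) ∧ En m (Epow α 0) = vt α :=
  Classical.epsilon_spec
    (p := fun η => η ∈ spanB m ((∑ i, α i) + 1) ∧ En m η = vt α)
    (existsUnique_En_eq hm _ (vt_mem_weightSpace rfl)).exists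

theorem En_Epow {m : ℕ} (hm : 1 ≤ m) (α : Fin m → ℕ) (k : ℕ) :
    En m (Epow α k) = Epow α (k + 1) := by
  cases k with
  | zero => rw [(Epow_zero_spec hm α).2]; simp [Epow]
  | succ k => rw [Epow, Epow, pow_succ', Module.End.mul_apply]

theorem Epow_succ_mem {m : ℕ} (α : Fin m → ℕ) (k : ℕ) :
    Epow α (k + 1) ∈ weightSpace m (∑ i, α i - k) :=
  En_pow_mem (vt_mem_weightSpace rfl) k

theorem bCoeff_one (n l j : ℕ) : bCoeff n l j 1 = 1 := by
  simp [bCoeff, sp_zero, qp_zero]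

/-- The recursion satisfied by the coefficients of `Φ (a)`; here `n - p - 1` is the number of
tensor factors to the right of the position `p`. -/
theorem bCoeff_succ {n p : ℕ} (hp : p < n) {l k : ℕ} (hk : k + 1 ≤ l) :
    bCoeff n l (p + 2) (k + 1) *
      (sp (n - p - 1 : ℕ) * qp (-2 * (l - (k + 1) : ℕ))) = -bCoeff n l (p + 2) k := by
  have h1 : (((-1 : LLˣ) ^ (((k + 1 : ℕ) : ℤ) - 1) : LLˣ) : LL) =
      -(((-1 : LLˣ) ^ ((k : ℤ) - 1) : LLˣ) : LL) := by
    rw [show (((k + 1 : ℕ) : ℤ) - 1) = ((k : ℤ) - 1) + 1 by push_cast; ring, zpow_add, zpow_one,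
      Units.val_mul, Units.val_neg, Units.val_one, mul_neg_one]
  have h2 : sp ((((k + 1 : ℕ) : ℤ) - 1) * (((p + 2 : ℕ) : ℤ) - n - 1)) * sp (n - p - 1 : ℕ) =
      sp (((k : ℤ) - 1) * (((p + 2 : ℕ) : ℤ) - n - 1)) := by
    rw [← sp_add, Nat.sub_sub, Nat.cast_sub (by omega)]
    refine congrArg sp ?_
    push_cast; ring
  have h3 : qp ((((k + 1 : ℕ) : ℤ) - 1) * (2 * (l : ℤ) - (k + 1 : ℕ) - 2)) *
      qp (-2 * (l - (k + 1) : ℕ)) = qp (((k : ℤ) - 1) * (2 * (l : ℤ) - k - 2)) := by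
    rw [← qp_add, Nat.cast_sub hk]
    refine congrArg qp ?_
    push_cast; ring
  rw [bCoeff, bCoeff, h1, ← h2, ← h3]
  ring

theorem En_phiA {n p : ℕ} (hp : p + 1 < n) (α : Fin (n - p - 1) → ℕ) :
    En n (phiA p α : Vpow n) = 0 := by
  have hm : 1 ≤ n - p - 1 := by omega
  obtain ⟨d, hd⟩ : ∃ d, d = ∑ i, α i := ⟨_, rfl⟩
  rw [phiA, ← hd, map_sum]
  have hterm : ∀ k, En n (bCoeff n (d + 1) (p + 2) k • prepend n p k (Epow α k)) =
      (if k = 0 then 0 else bCoeff n (d + 1) (p + 2) k •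
        prepend n p (k - 1) (Kn (n - p - 1) (Epow α k))) +
      bCoeff n (d + 1) (p + 2) k • prepend n p k (Epow α (k + 1)) := by
    intro k
    rw [map_smul, En_prepend (by omega), En_Epow hm, smul_add]
    split_ifs
    · rw [smul_zero]
    · rfl
  rw [Finset.sum_congr rfl fun k _ => hterm k, Finset.sum_add_distrib, Finset.sum_range_succ',
    if_pos rfl, add_zero,
    Finset.sum_range_succ (fun k => bCoeff n (d + 1) (p + 2) k • prepend n p k (Epow α (k + 1))),
    ← add_assoc, ← Finset.sum_add_distrib]
  have hlast : Epow α (d + 1 + 1) = 0 := by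
    have h := Epow_succ_mem α d
    rw [← hd, Nat.sub_self] at h
    rw [← En_Epow hm, En_eq_zero h]
  rw [hlast, map_zero, smul_zero, add_zero]
  refine Finset.sum_eq_zero fun k hk => ?_
  rw [Finset.mem_range] at hk
  have h := Epow_succ_mem α k
  rw [← hd] at h
  rw [if_neg (Nat.succ_ne_zero k), Nat.add_sub_cancel, Kn_of_mem h, map_smul, smul_smul]
  have hb := bCoeff_succ (n := n) (p := p) (by omega) (l := d + 1) (k := k) (by omega)
  rw [Nat.add_sub_add_right] at hb
  rw [hb, neg_smul, neg_add_cancel]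

theorem phiA_sub_mem_spanB {n p : ℕ} (hp : p + 1 < n) (α : Fin (n - p - 1) → ℕ) :
    phiA p α - vt (pad p 1 α) ∈ spanB n ((∑ i, α i) + 1) := by
  have hm : 1 ≤ n - p - 1 := by omega
  have hp' : p < n := by omega
  rw [phiA, Finset.sum_range_succ', Finset.sum_range_succ']
  have h1 : bCoeff n (∑ i, α i + 1) (p + 2) (0 + 1) • prepend n p (0 + 1) (Epow α (0 + 1)) =
      vt (pad p 1 α) := by
    rw [zero_add, bCoeff_one, one_smul, Epow, pow_zero, Module.End.one_apply, prepend_vt]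
  rw [h1, add_right_comm, add_sub_cancel_right]
  refine Submodule.add_mem _ (Submodule.sum_mem _ fun k hk => ?_) ?_
  · refine Submodule.smul_mem _ _ ?_
    rw [Finset.mem_range] at hk
    have := prepend_mem_spanB_of_two_le hp' (k := k + 1 + 1) (by omega) (Epow_succ_mem α (k + 1))
    rwa [show k + 1 + 1 + (∑ i, α i - (k + 1)) = ∑ i, α i + 1 by omega] at this
  · exact Submodule.smul_mem _ _ (prepend_zero_mem_spanB hp' (Epow_zero_spec hm α).1)

/-! ### The basis of `W_{n,l}` -/

theorem exists_eq_pad {n l : ℕ} {β : Fin n → ℕ} (hβ : β ∈ setA n (l + 1)) :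
    ∃ p, ∃ _ : p + 1 < n, ∃ α : Fin (n - p - 1) → ℕ, β = pad p 1 α ∧ ∑ i, α i = l := by
  obtain ⟨hs, ⟨k, h0, h1, hk⟩ | h⟩ := hβ
  · have h := eq_pad k.2 β fun j hj => h0 j hj
    rw [Fin.eta, h1] at h
    refine ⟨k, hk, _, h, ?_⟩
    rw [h, sum_pad k.2] at hs
    omega
  · omega

theorem Phi_vt_zero {n : ℕ} {β : Fin n → ℕ} (h : ∑ i, β i = 0) : Phi n (vt β) = vt β := by
  rw [← vpBasis_apply, Phi, Module.Basis.constr_basis, dif_neg, vpBasis_apply]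
  rintro ⟨p, hp, α, rfl⟩
  rw [sum_pad (by omega)] at h
  omega

theorem Phi_sub_mem_spanB {n l : ℕ} {β : Fin n → ℕ} (hβ : β ∈ setA n l) :
    Phi n (vt β) - vt β ∈ spanB n l := by
  cases l with
  | zero => rw [Phi_vt_zero hβ.1, sub_self]; exact Submodule.zero_mem _
  | succ l =>
    obtain ⟨p, hp, α, rfl, rfl⟩ := exists_eq_pad hβ
    rw [Phi_pad hp]
    exact phiA_sub_mem_spanB hp α

theorem Phi_mem_W {n l : ℕ} {β : Fin n → ℕ} (hβ : β ∈ setA n l) : Phi n (vt β) ∈ W n l := by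
  refine ⟨?_, ?_⟩
  · rw [SetLike.mem_coe, LinearMap.mem_ker]
    cases l with
    | zero => rw [Phi_vt_zero hβ.1]; exact En_eq_zero (vt_mem_weightSpace hβ.1)
    | succ l =>
      obtain ⟨p, hp, α, rfl, rfl⟩ := exists_eq_pad hβ
      rw [Phi_pad hp, En_phiA hp]
  · have := Submodule.add_mem _ (spanB_le_weightSpace n l (Phi_sub_mem_spanB hβ))
      (vt_mem_weightSpace hβ.1)
    rwa [sub_add_cancel] at this

theorem mem_setA_or_isB {n l : ℕ} (hn : 1 ≤ n) {β : Fin n → ℕ} (hβ : ∑ i, β i = l) :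
    β ∈ setA n l ∨ IsB β := by
  by_cases hl : l = 0
  · exact Or.inl ⟨hβ, Or.inr hl⟩
  obtain ⟨k, h0, h1⟩ := exists_leading hn β
  have hk : β k ≠ 0 := by
    intro hz
    refine hl (hβ ▸ Finset.sum_eq_zero fun i _ => ?_)
    rcases lt_trichotomy i k with h | rfl | h
    · exact h0 i h
    · exact hz
    · have h' : (k : ℕ) < i := h
      omega
  by_cases hk1 : 1 < β k
  · exact Or.inr ⟨k, h0, Or.inl hk1⟩
  by_cases hkn : (k : ℕ) + 1 = n
  · exact Or.inr ⟨k, h0, Or.inr ⟨by omega, hkn⟩⟩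
  · exact Or.inl ⟨hβ, Or.inl ⟨k, h0, by omega, by omega⟩⟩

theorem not_isB_of_mem_setA {n l : ℕ} {β : Fin n → ℕ} (hβ : β ∈ setA n l) : ¬ IsB β := by
  rintro ⟨k, h0, h1⟩
  obtain ⟨hs, ⟨k', h0', h1', hk'⟩ | hl⟩ := hβ
  · rcases lt_trichotomy k k' with h | rfl | h
    · have := h0' k h; omega
    · omega
    · have := h0 k' h; omega
  · rw [hl] at hs
    have := Finset.sum_eq_zero_iff.1 hs k (Finset.mem_univ k)
    omega

theorem repr_eq_zero_of_mem_spanB {n l l' : ℕ} {x : Vpow n} (hx : x ∈ spanB n l)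
    {β : Fin n → ℕ} (hβ : β ∈ setA n l') : (vpBasis n).repr x β = 0 := by
  have hle : spanB n l ≤ LinearMap.ker ((vpBasis n).coord β) := by
    rw [spanB, Submodule.span_le]
    rintro _ ⟨γ, ⟨-, hγ⟩, rfl⟩
    have hne : γ ≠ β := fun h => not_isB_of_mem_setA hβ (h ▸ hγ)
    rw [SetLike.mem_coe, LinearMap.mem_ker, ← vpBasis_apply, Module.Basis.coord_apply,
      Module.Basis.repr_self, Finsupp.single_eq_of_ne hne.symm]
  exact hle hx

theorem disjoint_spanB_ker {n l : ℕ} (hn : 1 ≤ n) {x : Vpow n} (hx : x ∈ spanB n l)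
    (h : En n x = 0) : x = 0 := by
  cases l with
  | zero =>
    have hbot : spanB n 0 = ⊥ := by
      rw [spanB, Submodule.span_eq_bot]
      rintro _ ⟨β, ⟨hs, hB⟩, rfl⟩
      exact absurd hB (not_isB_of_mem_setA ⟨hs, Or.inr rfl⟩)
    rwa [hbot] at hx
  | succ l => exact eq_zero_of_mem_spanB hn hx h

/-- The vector `Φ (a)` of `W_{n,l}`. -/
def phiW (n l : ℕ) (β : setA n l) : W n l := ⟨Phi n (vt (β : Fin n → ℕ)), Phi_mem_W β.2⟩

theorem linearIndependent_phiW (n l : ℕ) : LinearIndependent LL (phiW n l) := by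
  refine LinearIndependent.of_comp (W n l).subtype ?_
  rw [linearIndependent_iff']
  intro s c hc a ha
  have hrepr : ∀ b : setA n l, (vpBasis n).repr (Phi n (vt (b : Fin n → ℕ))) a =
      if b = a then 1 else 0 := by
    intro b
    have h := repr_eq_zero_of_mem_spanB (Phi_sub_mem_spanB b.2) a.2
    rw [map_sub, Finsupp.sub_apply, sub_eq_zero, ← vpBasis_apply, Module.Basis.repr_self,
      vpBasis_apply] at h
    rw [h, Finsupp.single_apply]
    simp only [Subtype.ext_iff]
  have h := congrArg (fun x => (vpBasis n).repr x a) hc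
  simp only [map_sum, map_smul, Finsupp.finsetSum_apply, Function.comp_apply, map_zero,
    Finsupp.smul_apply, Finsupp.zero_apply] at h
  rw [← h, Finset.sum_eq_single a]
  · change c a = c a • (vpBasis n).repr (Phi n (vt (a : Fin n → ℕ))) a
    rw [hrepr, if_pos rfl, smul_eq_mul, mul_one]
  · intro b _ hb
    change c b • (vpBasis n).repr (Phi n (vt (b : Fin n → ℕ))) a = 0
    rw [hrepr, if_neg hb, smul_zero]
  · exact fun h' => absurd ha h'

theorem span_phiW {n : ℕ} (hn : 1 ≤ n) (l : ℕ) :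
    ⊤ ≤ Submodule.span LL (Set.range (phiW n l)) := by
  have hmap : (Submodule.span LL (Set.range (phiW n l))).map (W n l).subtype ≤ W n l :=
    Submodule.map_subtype_le _ _
  have hle : weightSpace n l ≤
      (Submodule.span LL (Set.range (phiW n l))).map (W n l).subtype ⊔ spanB n l := by
    conv_lhs => rw [weightSpace_eq_span]
    rw [Submodule.span_le]
    rintro _ ⟨β, hβ, rfl⟩
    rcases mem_setA_or_isB hn hβ with hA | hB
    · rw [← sub_sub_cancel (Phi n (vt β)) (vt β)]
      refine Submodule.sub_mem _ (Submodule.mem_sup_left ?_)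
        (Submodule.mem_sup_right (Phi_sub_mem_spanB hA))
      exact ⟨phiW n l ⟨β, hA⟩, Submodule.subset_span ⟨_, rfl⟩, rfl⟩
    · exact Submodule.mem_sup_right (Submodule.subset_span ⟨β, ⟨hβ, hB⟩, rfl⟩)
  rintro ⟨w, hw⟩ -
  obtain ⟨x, hx, y, hy, rfl⟩ := Submodule.mem_sup.1 (hle hw.2)
  have hEx : En n x = 0 := (hmap hx).1
  have hE : En n (x + y) = 0 := hw.1
  rw [map_add, hEx, zero_add] at hE
  obtain rfl := disjoint_spanB_ker hn hy hE
  obtain ⟨z, hz, hzx⟩ := hx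
  have : z = ⟨x + 0, hw⟩ := Subtype.ext (hzx.trans (add_zero x).symm)
  rwa [← this]

/-- The basis of `W_{n,l}` formed by the `Φ (a)`. -/
def basisW {n : ℕ} (hn : 1 ≤ n) (l : ℕ) : Module.Basis (setA n l) LL (W n l) :=
  Module.Basis.mk (linearIndependent_phiW n l) (span_phiW hn l)

theorem basisW_apply {n : ℕ} (hn : 1 ≤ n) (l : ℕ) (β : setA n l) :
    (basisW hn l β : Vpow n) = Phi n (vt (β : Fin n → ℕ)) := by
  rw [basisW, Module.Basis.mk_apply]; rfl

/-! ### The cardinality of `𝒜_{n,l}` -/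

theorem finite_setOf_sum_eq (n l : ℕ) : {β : Fin n → ℕ | ∑ i, β i = l}.Finite :=
  Set.finite_coe_iff.1 (Finite.of_equiv _ (Sym.equivNatSumOfFintype (Fin n) l))

theorem ncard_setOf_sum_eq (n l : ℕ) :
    {β : Fin n → ℕ | ∑ i, β i = l}.ncard = (n + l - 1).choose l := by
  have h := Nat.card_congr (Sym.equivNatSumOfFintype (Fin n) l)
  rw [Nat.card_eq_fintype_card, Sym.card_sym_eq_choose, Fintype.card_fin] at h
  rw [h]
  rfl

theorem ncard_setA {n : ℕ} (hn : 1 ≤ n) (l : ℕ) : (setA n l).ncard = (n + l - 2).choose l := by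
  cases l with
  | zero =>
    have h : setA n 0 = {β : Fin n → ℕ | ∑ i, β i = 0} :=
      Set.ext fun β => ⟨fun h => h.1, fun h => ⟨h, Or.inr rfl⟩⟩
    rw [h, ncard_setOf_sum_eq]
    simp
  | succ l =>
    have h : {β : Fin n → ℕ | ∑ i, β i = l + 1} =
        setA n (l + 1) ∪ raise '' {β : Fin n → ℕ | ∑ i, β i = l} := by
      ext β
      constructor
      · intro hβ
        refine (mem_setA_or_isB hn hβ).imp id fun hB => ?_
        obtain ⟨γ, rfl⟩ := exists_raise_eq hB
        rw [Set.mem_ofPred_eq, sum_raise hn] at hβ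
        exact ⟨γ, Nat.succ_injective hβ, rfl⟩
      · rintro (hA | ⟨γ, hγ, rfl⟩)
        · exact hA.1
        · rw [Set.mem_ofPred_eq, sum_raise hn, hγ]
    have hdisj : Disjoint (setA n (l + 1)) (raise '' {β : Fin n → ℕ | ∑ i, β i = l}) := by
      rw [Set.disjoint_right]
      rintro _ ⟨γ, -, rfl⟩ hA
      exact not_isB_of_mem_setA hA (isB_raise hn γ)
    have hcard := congrArg Set.ncard h
    rw [Set.ncard_union_eq hdisj ((finite_setOf_sum_eq n (l + 1)).subset fun β hβ => hβ.1)
      ((finite_setOf_sum_eq n l).image _), Set.ncard_image_of_injective _ (raise_injective hn),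
      ncard_setOf_sum_eq, ncard_setOf_sum_eq] at hcard
    obtain ⟨n, rfl⟩ : ∃ m, n = m + 1 := ⟨n - 1, by omega⟩
    rw [show n + 1 + (l + 1) - 1 = (n + l) + 1 by omega, show n + 1 + l - 1 = n + l by omega,
      Nat.choose_succ_succ'] at hcard
    rw [show n + 1 + (l + 1) - 2 = n + l by omega]
    omega

theorem finite_setA (n l : ℕ) : (setA n l).Finite :=
  (finite_setOf_sum_eq n l).subset fun _ hβ => hβ.1

/-! ### The braiding on `V ⊗ V` commutes with `E` and `K` -/

/-- The coproduct `ΔE = E ⊗ K + 1 ⊗ E` on `V ⊗ V`. -/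
def deltaE : V ⊗[LL] V →ₗ[LL] V ⊗[LL] V :=
  TensorProduct.map E K + TensorProduct.map LinearMap.id E

theorem linearMap_ext_vv {M : Type*} [AddCommMonoid M] [Module LL M] {f g : V ⊗[LL] V →ₗ[LL] M}
    (h : ∀ a b, f (v a ⊗ₜ[LL] v b) = g (v a ⊗ₜ[LL] v b)) : f = g :=
  vvBasis.ext fun p => by rw [vvBasis_apply]; exact h p.1 p.2

theorem deltaE_v_tmul_v (i j : ℕ) : deltaE (v i ⊗ₜ[LL] v j) =
    (if i = 0 then 0 else (sp 1 * qp (-2 * j)) • (v (i - 1) ⊗ₜ[LL] v j)) +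
      (if j = 0 then 0 else v i ⊗ₜ[LL] v (j - 1)) := by
  rw [deltaE, LinearMap.add_apply, TensorProduct.map_tmul, TensorProduct.map_tmul, E_v, E_v, K_v,
    LinearMap.id_apply]
  refine congrArg₂ (· + ·) ?_ ?_
  · split_ifs
    · rw [TensorProduct.zero_tmul]
    · rw [TensorProduct.tmul_smul]
  · split_ifs
    · rw [TensorProduct.tmul_zero]
    · rfl

/-- The common factor of the coefficients of `v_(j+m) ⊗ v_t` in `R ΔE (v_(m+1+t) ⊗ v_j)` and in
`ΔE R (v_(m+1+t) ⊗ v_j)`. -/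
theorem coeffR_identities (t j m : ℕ) :
    ∃ A : LL, sp 1 * qp (-2 * j) * coeffR (m + t) j m =
        A * (sp 2 * qp (-2 * j) * coeffF m j) ∧
      coeffR (m + 1 + t) j (m + 1) * (sp 1 * qp (-2 * t)) =
        A * (sp 1 * qp m * coeffF (m + 1) j) ∧
      coeffR (m + 1 + t) j m = A * (qp (2 * ((j : ℤ) + m)) * coeffF m j) ∧
      ∀ j', j = j' + 1 → coeffR (m + 1 + t) j' (m + 1) =
        A * (sp 1 * qp m * coeffF (m + 1) j') := by
  refine ⟨sp (-((m : ℤ) + 1 + t + j)) * qp (2 * t * ((j : ℤ) + m)) * qp (tri m), ?_, ?_, ?_, ?_⟩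
  · have e1 : sp (-(((m + t : ℕ) : ℤ) + j)) * sp 1 = sp (-((m : ℤ) + 1 + t + j)) * sp 2 := by
      rw [← sp_add, ← sp_add]; refine congrArg sp ?_; push_cast; ring
    have e2 : (2 * (((m + t : ℕ) : ℤ) - m) * (j + m)) = 2 * t * ((j : ℤ) + m) := by
      push_cast; ring
    rw [coeffR, e2]
    linear_combination qp (-2 * j) * qp (2 * t * ((j : ℤ) + m)) * qp (tri m) * coeffF m j * e1
  · have e1 : (-(((m + 1 + t : ℕ) : ℤ) + j)) = -((m : ℤ) + 1 + t + j) := by push_cast; ring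
    have e2 : qp (2 * (((m + 1 + t : ℕ) : ℤ) - (m + 1 : ℕ)) * (j + (m + 1 : ℕ))) * qp (-2 * t) =
        qp (2 * t * ((j : ℤ) + m)) := by
      rw [← qp_add]; refine congrArg qp ?_; push_cast; ring
    rw [coeffR, e1, tri_succ, qp_add, ← e2]
    ring
  · have e1 : (-(((m + 1 + t : ℕ) : ℤ) + j)) = -((m : ℤ) + 1 + t + j) := by push_cast; ring
    have e2 : qp (2 * (((m + 1 + t : ℕ) : ℤ) - m) * (j + m)) =
        qp (2 * t * ((j : ℤ) + m)) * qp (2 * ((j : ℤ) + m)) := by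
      rw [← qp_add]; refine congrArg qp ?_; push_cast; ring
    rw [coeffR, e1, e2]
    ring
  · rintro j' rfl
    have e1 : sp (-(((m + 1 + t : ℕ) : ℤ) + j')) =
        sp (-((m : ℤ) + 1 + t + (j' + 1 : ℕ))) * sp 1 := by
      rw [← sp_add]; refine congrArg sp ?_; push_cast; ring
    have e2 : (2 * (((m + 1 + t : ℕ) : ℤ) - (m + 1 : ℕ)) * (j' + (m + 1 : ℕ))) =
        2 * t * (((j' + 1 : ℕ) : ℤ) + m) := by
      push_cast; ring
    rw [coeffR, e1, e2, tri_succ, qp_add]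
    ring

theorem sp_one_mul_sp_one : sp 1 * sp 1 = sp 2 := by rw [← sp_add]; rfl

theorem sp_one_mul_sp_neg_one : sp 1 * sp (-1) = 1 := by rw [← sp_add]; exact sp_zero

/-- Coefficient of `v_m ⊗ v_t` in `R ΔE = ΔE R` on `v_(m+1+t) ⊗ v_0`. -/
theorem coeffR_commute_zero (t m : ℕ) :
    sp 1 * qp (-2 * (0 : ℕ)) * coeffR (m + t) 0 m =
      coeffR (m + 1 + t) 0 (m + 1) * (sp 1 * qp (-2 * t)) + coeffR (m + 1 + t) 0 m := by
  obtain ⟨A, h1, h2, h3, -⟩ := coeffR_identities t 0 m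
  rw [h1, h2, h3, coeffF_succ_zero]
  have e1 : qp (m : ℤ) * qp (-(m : ℤ)) = qp (-2 * (0 : ℕ)) := by
    rw [← qp_add]; refine congrArg qp ?_; simp
  have e2 : qp (m : ℤ) * qp (m : ℤ) = qp (2 * (((0 : ℕ) : ℤ) + m)) := by
    rw [← qp_add]; refine congrArg qp ?_; simp; ring
  rw [← e1, ← e2, ← sp_one_mul_sp_one]
  linear_combination A * qp m * qp m * coeffF m 0 * sp_one_mul_sp_neg_one

/-- Coefficient of `v_(j+1+m) ⊗ v_t` in `R ΔE = ΔE R` on `v_(m+1+t) ⊗ v_(j+1)`. -/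
theorem coeffR_commute_succ (t j m : ℕ) :
    sp 1 * qp (-2 * (j + 1 : ℕ)) * coeffR (m + t) (j + 1) m + coeffR (m + 1 + t) j (m + 1) =
      coeffR (m + 1 + t) (j + 1) (m + 1) * (sp 1 * qp (-2 * t)) +
        coeffR (m + 1 + t) (j + 1) m := by
  obtain ⟨A, h1, h2, h3, h4⟩ := coeffR_identities t (j + 1) m
  rw [h1, h2, h3, h4 j rfl]
  have h := coeffF_succ_succ m j
  have e1 : qp (m : ℤ) * qp (-2 * ((j : ℤ) + 1) - m) = qp (-2 * (j + 1 : ℕ)) := by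
    rw [← qp_add]; refine congrArg qp ?_; push_cast; ring
  have e2 : qp (m : ℤ) * qp (2 * ((j : ℤ) + 1) + m) = qp (2 * (((j + 1 : ℕ) : ℤ) + m)) := by
    rw [← qp_add]; refine congrArg qp ?_; push_cast; ring
  rw [← e1, ← e2, ← sp_one_mul_sp_one]
  linear_combination (-A * sp 1 * qp m) * h +
    A * qp m * qp (2 * ((j : ℤ) + 1) + m) * coeffF m (j + 1) * sp_one_mul_sp_neg_one

theorem coeffR_zero_commute (i j : ℕ) :
    coeffR i j 0 = coeffR i (j + 1) 0 * (sp 1 * qp (-2 * i)) := by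
  rw [coeffR, coeffR, tri_zero, qp_zero, coeffF_zero, coeffF_zero]
  have e1 : sp (-((i : ℤ) + j)) = sp (-((i : ℤ) + (j + 1 : ℕ))) * sp 1 := by
    rw [← sp_add]; refine congrArg sp ?_; push_cast; ring
  have e2 : qp (2 * ((i : ℤ) - (0 : ℕ)) * (j + (0 : ℕ))) =
      qp (2 * ((i : ℤ) - (0 : ℕ)) * ((j + 1 : ℕ) + (0 : ℕ))) * qp (-2 * i) := by
    rw [← qp_add]; refine congrArg qp ?_; push_cast; ring
  rw [e1, e2]
  ring

theorem deltaE_R_v_tmul_v (i j : ℕ) : deltaE (R (v i ⊗ₜ[LL] v j)) =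
    (if j = 0 then 0 else
      (coeffR i j 0 * (sp 1 * qp (-2 * i))) • (v (j - 1) ⊗ₜ[LL] v i)) +
    ∑ m ∈ Finset.range i, (coeffR i j (m + 1) * (sp 1 * qp (-2 * (i - (m + 1) : ℕ))) +
      coeffR i j m) • (v (j + m) ⊗ₜ[LL] v (i - (m + 1))) := by
  have h : ∀ m, deltaE (coeffR i j m • (v (j + m) ⊗ₜ[LL] v (i - m))) =
      (if j + m = 0 then 0 else (coeffR i j m * (sp 1 * qp (-2 * (i - m : ℕ)))) •
        (v (j + m - 1) ⊗ₜ[LL] v (i - m))) +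
      (if i - m = 0 then 0 else coeffR i j m • (v (j + m) ⊗ₜ[LL] v (i - m - 1))) := by
    intro m
    rw [map_smul, deltaE_v_tmul_v, smul_add]
    refine congrArg₂ (· + ·) ?_ ?_
    · split_ifs
      · rw [smul_zero]
      · rw [smul_smul]
    · split_ifs
      · rw [smul_zero]
      · rfl
  rw [R_v_tmul_v, map_sum, Finset.sum_congr rfl fun m _ => h m, Finset.sum_add_distrib,
    Finset.sum_range_succ', Finset.sum_range_succ (fun m => if i - m = 0 then 0 else
      coeffR i j m • (v (j + m) ⊗ₜ[LL] v (i - m - 1))), if_pos (Nat.sub_self i), add_zero,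
    add_zero, add_right_comm, ← Finset.sum_add_distrib, add_comm]
  refine congrArg₂ (· + ·) rfl (Finset.sum_congr rfl fun m hm => ?_)
  rw [Finset.mem_range] at hm
  rw [if_neg (by omega), if_neg (by omega), Nat.sub_sub, add_smul]
  rfl

theorem R_deltaE_v_tmul_v (i j : ℕ) : R (deltaE (v i ⊗ₜ[LL] v j)) =
    (if j = 0 then 0 else coeffR i (j - 1) 0 • (v (j - 1) ⊗ₜ[LL] v i)) +
    ∑ m ∈ Finset.range i, (sp 1 * qp (-2 * j) * coeffR (i - 1) j m +
      if j = 0 then 0 else coeffR i (j - 1) (m + 1)) • (v (j + m) ⊗ₜ[LL] v (i - (m + 1))) := by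
  have h1 : R (if i = 0 then 0 else (sp 1 * qp (-2 * j)) • (v (i - 1) ⊗ₜ[LL] v j)) =
      ∑ m ∈ Finset.range i, (sp 1 * qp (-2 * j) * coeffR (i - 1) j m) •
        (v (j + m) ⊗ₜ[LL] v (i - (m + 1))) := by
    cases i with
    | zero => simp
    | succ i =>
      rw [if_neg (Nat.succ_ne_zero i), map_smul, R_v_tmul_v, Finset.smul_sum,
        Nat.add_sub_cancel]
      refine Finset.sum_congr rfl fun m _ => ?_
      rw [smul_smul, Nat.add_sub_add_right]
  have h2 : R (if j = 0 then 0 else v i ⊗ₜ[LL] v (j - 1)) =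
      (if j = 0 then 0 else coeffR i (j - 1) 0 • (v (j - 1) ⊗ₜ[LL] v i)) +
      ∑ m ∈ Finset.range i, (if j = 0 then 0 else coeffR i (j - 1) (m + 1)) •
        (v (j + m) ⊗ₜ[LL] v (i - (m + 1))) := by
    cases j with
    | zero => simp
    | succ j =>
      simp only [Nat.succ_ne_zero, if_false, Nat.add_sub_cancel]
      rw [R_v_tmul_v, Finset.sum_range_succ', add_comm]
      refine congrArg₂ (· + ·) rfl (Finset.sum_congr rfl fun m _ => ?_)
      rw [show j + (m + 1) = j + 1 + m by omega]
  rw [deltaE_v_tmul_v, map_add, h1, h2, add_left_comm, ← Finset.sum_add_distrib]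
  refine congrArg₂ (· + ·) rfl (Finset.sum_congr rfl fun m _ => ?_)
  rw [add_smul]

theorem R_comp_deltaE : R ∘ₗ deltaE = deltaE ∘ₗ R := by
  refine linearMap_ext_vv fun i j => ?_
  rw [LinearMap.comp_apply, LinearMap.comp_apply, deltaE_R_v_tmul_v, R_deltaE_v_tmul_v]
  refine congrArg₂ (· + ·) ?_ (Finset.sum_congr rfl fun m hm => ?_)
  · split_ifs with hj
    · rfl
    · obtain ⟨j, rfl⟩ := Nat.exists_eq_succ_of_ne_zero hj
      rw [Nat.succ_sub_one, coeffR_zero_commute i j]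
  · refine congrArg (· • _) ?_
    rw [Finset.mem_range] at hm
    obtain ⟨t, rfl⟩ : ∃ t, i = m + 1 + t := ⟨i - (m + 1), by omega⟩
    rw [show m + 1 + t - (m + 1) = t by omega, show m + 1 + t - 1 = m + t by omega]
    cases j with
    | zero => rw [if_pos rfl, add_zero]; exact coeffR_commute_zero t m
    | succ j =>
      rw [if_neg (Nat.succ_ne_zero j), Nat.add_sub_cancel]
      exact coeffR_commute_succ t j m

theorem R_comp_deltaE_pow (N : ℕ) : R ∘ₗ (deltaE ^ N) = (deltaE ^ N) ∘ₗ R :=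
  (show Commute R deltaE from R_comp_deltaE).pow_right N

theorem map_K_K_v_tmul_v (a b : ℕ) : TensorProduct.map K K (v a ⊗ₜ[LL] v b) =
    (sp 2 * qp (-2 * ((a + b : ℕ) : ℤ))) • (v a ⊗ₜ[LL] v b) := by
  have e : qp (-2 * ((a + b : ℕ) : ℤ)) = qp (-2 * (a : ℤ)) * qp (-2 * (b : ℤ)) := by
    rw [← qp_add]; refine congrArg qp ?_; push_cast; ring
  rw [TensorProduct.map_tmul, K_v, K_v, TensorProduct.smul_tmul_smul, e, ← sp_one_mul_sp_one]
  refine congrArg (· • _) ?_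
  ring

theorem R_comp_map_K_K : R ∘ₗ TensorProduct.map K K = TensorProduct.map K K ∘ₗ R := by
  refine linearMap_ext_vv fun i j => ?_
  rw [LinearMap.comp_apply, LinearMap.comp_apply, map_K_K_v_tmul_v, map_smul, R_v_tmul_v, map_sum,
    Finset.smul_sum]
  refine Finset.sum_congr rfl fun m hm => ?_
  rw [Finset.mem_range] at hm
  rw [map_smul, map_K_K_v_tmul_v, smul_smul, smul_smul, mul_comm,
    show j + m + (i - m) = i + j by omega]

/-! ### Powers of the coproduct of `E` -/

/-- The coefficient of `E^k ⊗ E^m` in `(ΔE)^(k+m)`, acting on `v_a ⊗ v_b`. -/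
def coeffDelta (b k m : ℕ) : LL :=
  qp ((k : ℤ) * m) * qBinom (k + m) m * (sp k * qp (-2 * (b : ℤ) * k))

theorem coeffDelta_eq (b k m : ℕ) (h : k + m ≠ 0) : coeffDelta b k m =
    (if k = 0 then 0 else sp 1 * qp (-2 * ((b : ℤ) - m)) * coeffDelta b (k - 1) m) +
      (if m = 0 then 0 else coeffDelta b k (m - 1)) := by
  cases k with
  | zero =>
    cases m with
    | zero => exact absurd rfl h
    | succ m =>
      rw [if_pos rfl, if_neg (Nat.succ_ne_zero m), zero_add, Nat.add_sub_cancel, coeffDelta,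
        coeffDelta, zero_add, zero_add, qBinom_self, qBinom_self, Nat.cast_zero, zero_mul, zero_mul]
  | succ k =>
    have hs : sp ((k + 1 : ℕ) : ℤ) = sp 1 * sp k := by
      rw [← sp_add]; refine congrArg sp ?_; push_cast; ring
    have hq : ∀ m : ℕ, qp (((k + 1 : ℕ) : ℤ) * m) * qp (-2 * (b : ℤ) * (k + 1 : ℕ)) * qp m =
        qp (-2 * ((b : ℤ) - m)) * (qp ((k : ℤ) * m) * qp (-2 * (b : ℤ) * k)) := by
      intro m
      rw [← qp_add, ← qp_add, ← qp_add, ← qp_add]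
      refine congrArg qp ?_; push_cast; ring
    cases m with
    | zero =>
      rw [if_neg (Nat.succ_ne_zero k), if_pos rfl, add_zero, Nat.add_sub_cancel, coeffDelta,
        coeffDelta, qBinom_zero_right, qBinom_zero_right, hs]
      have := hq 0
      rw [Nat.cast_zero, qp_zero] at this
      rw [Nat.cast_zero]
      linear_combination sp 1 * sp k * this
    | succ m =>
      rw [if_neg (Nat.succ_ne_zero k), if_neg (Nat.succ_ne_zero m), Nat.add_sub_cancel,
        Nat.add_sub_cancel, coeffDelta, coeffDelta, coeffDelta, hs]
      have hB : qBinom (k + 1 + (m + 1)) (m + 1) = qp ((m + 1 : ℕ) : ℤ) *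
          qBinom (k + (m + 1)) (m + 1) + qp (-((k : ℤ) + 1)) * qBinom (k + 1 + m) m := by
        rw [show k + 1 + (m + 1) = (k + 1 + m) + 1 by omega, qBinom,
          show k + (m + 1) = k + 1 + m by omega]
        refine congrArg₂ (· + ·) rfl (congrArg (· * _) (congrArg qp ?_))
        push_cast; ring
      have hq' : qp (((k + 1 : ℕ) : ℤ) * (m + 1 : ℕ)) * qp (-((k : ℤ) + 1)) =
          qp (((k + 1 : ℕ) : ℤ) * m) := by
        rw [← qp_add]
        refine congrArg qp ?_; push_cast; ring
      rw [hB]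
      linear_combination sp 1 * sp k * qBinom (k + (m + 1)) (m + 1) * hq (m + 1) +
        qBinom (k + 1 + m) m * (sp 1 * sp k * qp (-2 * (b : ℤ) * (k + 1 : ℕ))) * hq'

theorem K_E_pow_v (m b : ℕ) :
    K ((E ^ m) (v b)) = (sp 1 * qp (-2 * ((b : ℤ) - m))) • (E ^ m) (v b) := by
  rw [E_pow_v]
  split_ifs with h
  · rw [K_v, Nat.cast_sub h]
  · rw [map_zero, smul_zero]

/-- The `q`-binomial theorem for `ΔE = E ⊗ K + 1 ⊗ E`. -/
theorem deltaE_pow_v_tmul_v (a b N : ℕ) : (deltaE ^ N) (v a ⊗ₜ[LL] v b) =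
    ∑ p ∈ Finset.HasAntidiagonal.antidiagonal N, coeffDelta b p.1 p.2 •
      ((E ^ p.1) (v a) ⊗ₜ[LL] (E ^ p.2) (v b)) := by
  induction N with
  | zero => simp [coeffDelta, qp_zero, sp_zero, qBinom_zero_right]
  | succ N ih =>
    have hterm : ∀ k m, deltaE (coeffDelta b k m • ((E ^ k) (v a) ⊗ₜ[LL] (E ^ m) (v b))) =
        (sp 1 * qp (-2 * ((b : ℤ) - m)) * coeffDelta b k m) •
          ((E ^ (k + 1)) (v a) ⊗ₜ[LL] (E ^ m) (v b)) +
        coeffDelta b k m • ((E ^ k) (v a) ⊗ₜ[LL] (E ^ (m + 1)) (v b)) := by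
      intro k m
      rw [map_smul, deltaE, LinearMap.add_apply, TensorProduct.map_tmul, TensorProduct.map_tmul,
        K_E_pow_v, LinearMap.id_apply, TensorProduct.tmul_smul, smul_add, smul_smul,
        mul_comm (coeffDelta b k m), pow_succ', pow_succ', Module.End.mul_apply,
        Module.End.mul_apply]
    have hsplit : ∀ p ∈ Finset.HasAntidiagonal.antidiagonal (N + 1), coeffDelta b p.1 p.2 •
        ((E ^ p.1) (v a) ⊗ₜ[LL] (E ^ p.2) (v b)) =
        (if p.1 = 0 then 0 else sp 1 * qp (-2 * ((b : ℤ) - p.2)) * coeffDelta b (p.1 - 1) p.2) •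
          ((E ^ p.1) (v a) ⊗ₜ[LL] (E ^ p.2) (v b)) +
        (if p.2 = 0 then 0 else coeffDelta b p.1 (p.2 - 1)) •
          ((E ^ p.1) (v a) ⊗ₜ[LL] (E ^ p.2) (v b)) := by
      intro p hp
      rw [Finset.HasAntidiagonal.mem_antidiagonal] at hp
      rw [← add_smul, ← coeffDelta_eq b p.1 p.2 (by omega)]
    rw [pow_succ', Module.End.mul_apply, ih, map_sum, Finset.sum_congr rfl hsplit,
      Finset.sum_congr rfl fun p _ => hterm p.1 p.2, Finset.sum_add_distrib,
      Finset.sum_add_distrib, Finset.Nat.sum_antidiagonal_succ, Finset.Nat.sum_antidiagonal_succ']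
    simp

/-! ### The operators `σ_i` -/

/-- The left of the two positions on which `σ_i` acts. -/
abbrev leftPos {n : ℕ} (i : Fin (n - 1)) : Fin n := ⟨i, by omega⟩

/-- The right of the two positions on which `σ_i` acts. -/
abbrev rightPos {n : ℕ} (i : Fin (n - 1)) : Fin n := ⟨i + 1, by omega⟩

theorem leftPos_ne_rightPos {n : ℕ} (i : Fin (n - 1)) : leftPos i ≠ rightPos i := by
  simp [leftPos, rightPos]

/-- `β` with the entries in the positions `i`, `i + 1` replaced by `a`, `b`. -/
def setPair {n : ℕ} {A : Type*} (i : Fin (n - 1)) (β : Fin n → A) (a b : A) : Fin n → A :=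
  Function.update (Function.update β (leftPos i) a) (rightPos i) b

section setPair

variable {n : ℕ} {A : Type*} (i : Fin (n - 1)) (β : Fin n → A) (a b : A)

theorem setPair_left : setPair i β a b (leftPos i) = a := by
  rw [setPair, Function.update_of_ne (leftPos_ne_rightPos i), Function.update_self]

theorem setPair_right : setPair i β a b (rightPos i) = b := by
  rw [setPair, Function.update_self]

theorem setPair_of_ne {k : Fin n} (h1 : k ≠ leftPos i) (h2 : k ≠ rightPos i) :
    setPair i β a b k = β k := by
  rw [setPair, Function.update_of_ne h2, Function.update_of_ne h1]

theorem setPair_self : setPair i β (β (leftPos i)) (β (rightPos i)) = β := by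
  rw [setPair, Function.update_eq_self, Function.update_eq_self]

theorem eq_setPair {γ : Fin n → A} (h1 : γ (leftPos i) = a) (h2 : γ (rightPos i) = b)
    (h : ∀ k, k ≠ leftPos i → k ≠ rightPos i → γ k = β k) : γ = setPair i β a b := by
  funext k
  by_cases hk : k = leftPos i
  · rw [hk, setPair_left, h1]
  by_cases hk' : k = rightPos i
  · rw [hk', setPair_right, h2]
  rw [setPair_of_ne i β a b hk hk', h k hk hk']

theorem setPair_setPair (a' b' : A) : setPair i (setPair i β a' b') a b = setPair i β a b :=
  eq_setPair i β a b (setPair_left ..) (setPair_right ..) fun k h1 h2 => by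
    rw [setPair_of_ne i _ a b h1 h2, setPair_of_ne i β a' b' h1 h2]

theorem setPair_comp {B : Type*} (f : A → B) :
    (fun k => f (setPair i β a b k)) = setPair i (fun k => f (β k)) (f a) (f b) :=
  eq_setPair i _ _ _ (congrArg f (setPair_left ..)) (congrArg f (setPair_right ..))
    fun _ h1 h2 => congrArg f (setPair_of_ne i β a b h1 h2)

end setPair

theorem sum_setPair {n : ℕ} (i : Fin (n - 1)) (β : Fin n → ℕ) (a b : ℕ)
    (h : a + b = β (leftPos i) + β (rightPos i)) : ∑ k, setPair i β a b k = ∑ k, β k := by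
  have hr : rightPos i ∈ Finset.univ.erase (leftPos i) :=
    Finset.mem_erase.2 ⟨(leftPos_ne_rightPos i).symm, Finset.mem_univ _⟩
  rw [← Finset.add_sum_erase _ _ (Finset.mem_univ (leftPos i)), ← Finset.add_sum_erase _ _ hr,
    ← Finset.add_sum_erase Finset.univ β (Finset.mem_univ (leftPos i)),
    ← Finset.add_sum_erase _ β hr, setPair_left, setPair_right, ← add_assoc, ← add_assoc, h]
  refine congrArg _ (Finset.sum_congr rfl fun k hk => ?_)
  rw [Finset.mem_erase, Finset.mem_erase] at hk
  exact setPair_of_ne i β a b hk.2.1 hk.1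

theorem insertPair_tmul {n : ℕ} (i : Fin (n - 1)) (x : Fin n → V) (a b : V) :
    insertPair i x (a ⊗ₜ[LL] b) = PiTensorProduct.tprod LL (setPair i x a b) := rfl

theorem insertPair_v_tmul_v {n : ℕ} (i : Fin (n - 1)) (β : Fin n → ℕ) (a b : ℕ) :
    insertPair i (fun k => v (β k)) (v a ⊗ₜ[LL] v b) = vt (setPair i β a b) := by
  rw [insertPair_tmul, vt, setPair_comp i β a b v]

theorem insertPair_congr {n : ℕ} (i : Fin (n - 1)) {x y : Fin n → V}
    (h : ∀ k, k ≠ leftPos i → k ≠ rightPos i → x k = y k) : insertPair i x = insertPair i y := by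
  refine TensorProduct.ext' fun a b => ?_
  rw [insertPair_tmul, insertPair_tmul]
  refine congrArg _ (eq_setPair i y a b (setPair_left ..) (setPair_right ..) fun k h1 h2 => ?_)
  rw [setPair_of_ne i x a b h1 h2, h k h1 h2]

theorem setPair_update {n : ℕ} (i : Fin (n - 1)) (x : Fin n → V) (a b : V) {k : Fin n}
    (h1 : k ≠ leftPos i) (h2 : k ≠ rightPos i) (y : V) :
    setPair i (Function.update x k y) a b = Function.update (setPair i x a b) k y := by
  rw [setPair, setPair, Function.update_comm h1, Function.update_comm h2]

theorem sigma_vt {n : ℕ} (i : Fin (n - 1)) (β : Fin n → ℕ) : sigma i (vt β) =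
    insertPair i (fun k => v (β k)) (R (v (β (leftPos i)) ⊗ₜ[LL] v (β (rightPos i)))) := by
  rw [← vpBasis_apply, sigma, Module.Basis.constr_basis]

/-- `σ_i` acts as `R` on the positions `i`, `i + 1`, whatever stands in the other positions. -/
theorem sigma_insertPair {n : ℕ} (i : Fin (n - 1)) (x : Fin n → V) (X : V ⊗[LL] V) :
    sigma i (insertPair i x X) = insertPair i x (R X) := by
  -- The right-hand side on pure tensors, as a multilinear map in all factors.
  let f : MultilinearMap LL (fun _ : Fin n => V) (Vpow n) :=
    { toFun := fun x => insertPair i x (R (x (leftPos i) ⊗ₜ[LL] x (rightPos i)))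
      map_update_add' := by
        intro dec x k y z
        obtain rfl : dec = instDecidableEqFin n := Subsingleton.elim _ _
        by_cases h1 : k = leftPos i
        · subst h1
          have hc : ∀ w, insertPair i (Function.update x (leftPos i) w) = insertPair i x :=
            fun w => insertPair_congr i fun k h _ => Function.update_of_ne h _ _
          simp only [hc, Function.update_self,
            Function.update_of_ne (leftPos_ne_rightPos i).symm, TensorProduct.add_tmul, map_add]
        by_cases h2 : k = rightPos i
        · subst h2
          have hc : ∀ w, insertPair i (Function.update x (rightPos i) w) = insertPair i x :=
            fun w => insertPair_congr i fun k _ h => Function.update_of_ne h _ _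
          simp only [hc, Function.update_self,
            Function.update_of_ne (leftPos_ne_rightPos i), TensorProduct.tmul_add, map_add]
        have hadd : insertPair i (Function.update x k (y + z)) =
            insertPair i (Function.update x k y) + insertPair i (Function.update x k z) := by
          refine TensorProduct.ext' fun a b => ?_
          simp only [LinearMap.add_apply, insertPair_tmul, setPair_update i x a b h1 h2,
            MultilinearMap.map_update_add]
        simp only [Function.update_of_ne (Ne.symm h1), Function.update_of_ne (Ne.symm h2), hadd,
          LinearMap.add_apply]
      map_update_smul' := by
        intro dec x k c y
        obtain rfl : dec = instDecidableEqFin n := Subsingleton.elim _ _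
        by_cases h1 : k = leftPos i
        · subst h1
          have hc : ∀ w, insertPair i (Function.update x (leftPos i) w) = insertPair i x :=
            fun w => insertPair_congr i fun k h _ => Function.update_of_ne h _ _
          simp only [hc, Function.update_self,
            Function.update_of_ne (leftPos_ne_rightPos i).symm, ← TensorProduct.smul_tmul',
            map_smul]
        by_cases h2 : k = rightPos i
        · subst h2
          have hc : ∀ w, insertPair i (Function.update x (rightPos i) w) = insertPair i x :=
            fun w => insertPair_congr i fun k _ h => Function.update_of_ne h _ _
          simp only [hc, Function.update_self,
            Function.update_of_ne (leftPos_ne_rightPos i), TensorProduct.tmul_smul, map_smul]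
        have hsmul : insertPair i (Function.update x k (c • y)) =
            c • insertPair i (Function.update x k y) := by
          refine TensorProduct.ext' fun a b => ?_
          simp only [LinearMap.smul_apply, insertPair_tmul, setPair_update i x a b h1 h2,
            MultilinearMap.map_update_smul]
        simp only [Function.update_of_ne (Ne.symm h1), Function.update_of_ne (Ne.symm h2), hsmul,
          LinearMap.smul_apply] }
  have hf : (sigma i).compMultilinearMap (PiTensorProduct.tprod LL) = f := by
    refine Module.Basis.ext_multilinear (fun _ => vBasis) fun β => ?_
    simp only [vBasis_apply]
    exact sigma_vt i β
  have hcomp : sigma i ∘ₗ insertPair i x = insertPair i x ∘ₗ R := by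
    refine TensorProduct.ext' fun a b => ?_
    rw [LinearMap.comp_apply, LinearMap.comp_apply, insertPair_tmul]
    have h := congrArg (fun g => g (setPair i x a b)) hf
    refine h.trans ?_
    change insertPair i (setPair i x a b) (R (setPair i x a b (leftPos i) ⊗ₜ[LL]
      setPair i x a b (rightPos i))) = _
    rw [setPair_left, setPair_right,
      insertPair_congr i fun k h1 h2 => setPair_of_ne i x a b h1 h2]
  exact LinearMap.congr_fun hcomp X

theorem sigma_vt_setPair {n : ℕ} (i : Fin (n - 1)) (β : Fin n → ℕ) (a b : ℕ) :
    sigma i (vt (setPair i β a b)) =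
      ∑ m ∈ Finset.range (a + 1), coeffR a b m • vt (setPair i β (b + m) (a - m)) := by
  rw [← insertPair_v_tmul_v, sigma_insertPair, R_v_tmul_v, map_sum]
  refine Finset.sum_congr rfl fun m _ => ?_
  rw [map_smul, insertPair_v_tmul_v]

/-! ### The operators `σ_i` commute with `E` and preserve the weight spaces -/

theorem map_insertPair {n : ℕ} (i : Fin (n - 1)) (g : Fin n → V →ₗ[LL] V) (x : Fin n → V)
    (X : V ⊗[LL] V) : PiTensorProduct.map g (insertPair i x X) =
      insertPair i (fun k => g k (x k)) (TensorProduct.map (g (leftPos i)) (g (rightPos i)) X) := by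
  have h : PiTensorProduct.map g ∘ₗ insertPair i x =
      insertPair i (fun k => g k (x k)) ∘ₗ TensorProduct.map (g (leftPos i)) (g (rightPos i)) := by
    refine TensorProduct.ext' fun a b => ?_
    rw [LinearMap.comp_apply, LinearMap.comp_apply, TensorProduct.map_tmul, insertPair_tmul,
      insertPair_tmul, PiTensorProduct.map_tprod]
    refine congrArg _ (eq_setPair i _ _ _ ?_ ?_ fun k h1 h2 => ?_)
    · rw [setPair_left]
    · rw [setPair_right]
    · rw [setPair_of_ne i x a b h1 h2]
  exact LinearMap.congr_fun h X

/-- The factors of the `j`-th summand of the action of `E` on `V^{⊗ n}`. -/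
def factorE {n : ℕ} (j k : Fin n) : V →ₗ[LL] V :=
  if k < j then LinearMap.id else if k = j then E else K

theorem En_eq_sum {n : ℕ} : En n = ∑ j : Fin n, PiTensorProduct.map (factorE j) := rfl

theorem En_insertPair {n : ℕ} (i : Fin (n - 1)) (x : Fin n → V) (X : V ⊗[LL] V) :
    En n (insertPair i x X) =
      insertPair i (fun k => factorE (leftPos i) k (x k)) (deltaE X) +
      ∑ j ∈ (Finset.univ.erase (leftPos i)).erase (rightPos i),
        insertPair i (fun k => factorE j k (x k))
          ((if j < leftPos i then TensorProduct.map K K else LinearMap.id) X) := by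
  have hr : rightPos i ∈ Finset.univ.erase (leftPos i) :=
    Finset.mem_erase.2 ⟨(leftPos_ne_rightPos i).symm, Finset.mem_univ _⟩
  have hlr : leftPos i < rightPos i := by simp [Fin.lt_def]
  rw [En_eq_sum, LinearMap.sum_apply, ← Finset.add_sum_erase _ _ (Finset.mem_univ (leftPos i)),
    ← Finset.add_sum_erase _ _ hr, ← add_assoc]
  refine congrArg₂ (· + ·) ?_ (Finset.sum_congr rfl fun j hj => ?_)
  · have hc : insertPair i (fun k => factorE (rightPos i) k (x k)) =
        insertPair i (fun k => factorE (leftPos i) k (x k)) := by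
      refine insertPair_congr i fun k h1 h2 => ?_
      have h3 : k < rightPos i ↔ k < leftPos i := by
        simp only [Fin.lt_def, ne_eq, Fin.ext_iff] at *
        omega
      simp only [factorE, h1, h2, h3, if_false]
    have e1 : factorE (leftPos i) (leftPos i) = E := by simp [factorE]
    have e2 : factorE (leftPos i) (rightPos i) = K := by
      rw [factorE, if_neg hlr.le.not_gt, if_neg hlr.ne']
    have e3 : factorE (rightPos i) (leftPos i) = LinearMap.id := by rw [factorE, if_pos hlr]
    have e4 : factorE (rightPos i) (rightPos i) = E := by simp [factorE]
    rw [map_insertPair, map_insertPair, hc, ← map_add, deltaE, LinearMap.add_apply, e1, e2, e3, e4]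
  · rw [Finset.mem_erase, Finset.mem_erase] at hj
    rw [map_insertPair]
    refine congrArg _ ?_
    split_ifs with h
    · have e1 : factorE j (leftPos i) = K := by
        rw [factorE, if_neg h.le.not_gt, if_neg h.ne']
      have e2 : factorE j (rightPos i) = K := by
        rw [factorE, if_neg (h.trans hlr).le.not_gt, if_neg (h.trans hlr).ne']
      rw [e1, e2]
    · have h' : rightPos i < j := by
        simp only [Fin.lt_def, ne_eq, Fin.ext_iff] at *
        omega
      rw [factorE, factorE, if_pos h', if_pos (hlr.trans h'), TensorProduct.map_id]

theorem vpow_ext {n : ℕ} {M : Type*} [AddCommMonoid M] [Module LL M] {f g : Vpow n →ₗ[LL] M}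
    (h : ∀ β, f (vt β) = g (vt β)) : f = g :=
  (vpBasis n).ext fun β => by rw [vpBasis_apply]; exact h β

theorem vt_eq_insertPair {n : ℕ} (i : Fin (n - 1)) (β : Fin n → ℕ) : vt β =
    insertPair i (fun k => v (β k)) (v (β (leftPos i)) ⊗ₜ[LL] v (β (rightPos i))) := by
  rw [insertPair_v_tmul_v, setPair_self]

theorem En_sigma {n : ℕ} (i : Fin (n - 1)) (y : Vpow n) :
    En n (sigma i y) = sigma i (En n y) := by
  have h : En n ∘ₗ sigma i = sigma i ∘ₗ En n := by
    refine vpow_ext fun β => ?_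
    rw [LinearMap.comp_apply, LinearMap.comp_apply, vt_eq_insertPair i β, sigma_insertPair,
      En_insertPair, En_insertPair, map_add, map_sum, sigma_insertPair]
    refine congrArg₂ (· + ·) ?_ (Finset.sum_congr rfl fun j _ => ?_)
    · rw [← LinearMap.comp_apply deltaE R, ← R_comp_deltaE, LinearMap.comp_apply]
    · rw [sigma_insertPair]
      refine congrArg _ ?_
      split_ifs
      · rw [← LinearMap.comp_apply _ R, ← R_comp_map_K_K, LinearMap.comp_apply]
      · rfl
  exact LinearMap.congr_fun h y

theorem sigma_mem_weightSpace {n l : ℕ} (i : Fin (n - 1)) {y : Vpow n}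
    (hy : y ∈ weightSpace n l) : sigma i y ∈ weightSpace n l :=
  map_mem_of_vt _ _ (fun β hβ => by
    rw [← setPair_self i β, sigma_vt_setPair]
    refine Submodule.sum_mem _ fun m hm => Submodule.smul_mem _ _ (vt_mem_weightSpace ?_)
    rw [Finset.mem_range] at hm
    rw [sum_setPair, hβ]
    omega) hy

theorem isUnit_coeffR_zero (i j : ℕ) : IsUnit (coeffR i j 0) := by
  rw [coeffR, coeffF_zero, mul_one]
  exact ((isUnit_sp _).mul (isUnit_qp _)).mul (isUnit_qp _)

/-- Triangularity of `R`: up to a unit, `R (v_t ⊗ v_a)` is `v_a ⊗ v_t` plus terms `v_(a+m) ⊗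
v_(t-m)` with `m > 0`. -/
theorem vt_mem_map_sigma {n l : ℕ} (i : Fin (n - 1)) (t : ℕ) :
    ∀ (β : Fin n → ℕ) (a : ℕ), ∑ k, setPair i β a t k = l →
      vt (setPair i β a t) ∈ (weightSpace n l).map (sigma i) := by
  induction t using Nat.strong_induction_on with
  | _ t ih =>
    intro β a hl
    have hswap : ∀ a' t', a' + t' = a + t → ∑ k, setPair i β a' t' k = l := by
      intro a' t' h
      rw [← hl, ← sum_setPair i (setPair i β a t) a' t' (by rw [setPair_left, setPair_right, h]),
        setPair_setPair]
    have h := sigma_vt_setPair i β t a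
    rw [Finset.sum_range_succ', add_zero, Nat.sub_zero] at h
    have hrest : ∑ m ∈ Finset.range t, coeffR t a (m + 1) •
        vt (setPair i β (a + (m + 1)) (t - (m + 1))) ∈ (weightSpace n l).map (sigma i) := by
      refine Submodule.sum_mem _ fun m hm => Submodule.smul_mem _ _ ?_
      rw [Finset.mem_range] at hm
      exact ih _ (by omega) β _ (hswap _ _ (by omega))
    have hmem : sigma i (vt (setPair i β t a)) ∈ (weightSpace n l).map (sigma i) :=
      Submodule.mem_map_of_mem (vt_mem_weightSpace (hswap _ _ (add_comm _ _)))
    have hlead := Submodule.sub_mem _ hmem hrest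
    rw [h, add_sub_cancel_left] at hlead
    obtain ⟨u, hu⟩ := isUnit_coeffR_zero t a
    rw [← hu] at hlead
    have := Submodule.smul_mem _ ((u⁻¹ : LLˣ) : LL) hlead
    rwa [smul_smul, Units.inv_mul, one_smul] at this

/-- `σ_i` as an endomorphism of `V_{n,l}`. -/
def sigmaWeight {n : ℕ} (i : Fin (n - 1)) (l : ℕ) : weightSpace n l →ₗ[LL] weightSpace n l :=
  (sigma i).restrict fun _ hy => sigma_mem_weightSpace i hy

theorem sigmaWeight_bijective {n : ℕ} (i : Fin (n - 1)) (l : ℕ) :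
    Function.Bijective (sigmaWeight i l) := by
  refine OrzechProperty.bijective_of_surjective_endomorphism _ ?_
  rintro ⟨y, hy⟩
  have hle : weightSpace n l ≤ (weightSpace n l).map (sigma i) := by
    conv_lhs => rw [weightSpace_eq_span]
    rw [Submodule.span_le]
    rintro _ ⟨β, hβ, rfl⟩
    rw [SetLike.mem_coe, ← setPair_self i β]
    exact vt_mem_map_sigma i _ β _ (by rw [setPair_self]; exact hβ)
  obtain ⟨x, hx, hxy⟩ := hle hy
  exact ⟨⟨x, hx⟩, Subtype.ext hxy⟩

theorem sigma_mem_W {n l : ℕ} (i : Fin (n - 1)) {y : Vpow n} (hy : y ∈ W n l) :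
    sigma i y ∈ W n l := by
  refine ⟨?_, sigma_mem_weightSpace i hy.2⟩
  have h : En n y = 0 := hy.1
  rw [SetLike.mem_coe, LinearMap.mem_ker, En_sigma, h, map_zero]

theorem sigma_restrict_W_bijective {n l : ℕ} (i : Fin (n - 1)) :
    Function.Bijective ((sigma i).restrict fun _ hy => sigma_mem_W (l := l) i hy) := by
  have hinj : ∀ l, ∀ y ∈ weightSpace n l, ∀ z ∈ weightSpace n l, sigma i y = sigma i z → y = z :=
    fun l y hy z hz h => Subtype.mk.inj
      ((sigmaWeight_bijective i l).1 (a₁ := ⟨y, hy⟩) (a₂ := ⟨z, hz⟩) (Subtype.ext h))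
  constructor
  · rintro ⟨y, hy⟩ ⟨z, hz⟩ h
    exact Subtype.ext (hinj l y hy.2 z hz.2 (Subtype.mk.inj h))
  · rintro ⟨w, hw⟩
    obtain ⟨⟨u, hu⟩, huw⟩ := (sigmaWeight_bijective i l).2 ⟨w, hw.2⟩
    have huw' : sigma i u = w := Subtype.mk.inj huw
    -- `u` is a highest weight vector, since `σ_i` is injective on `V_{n,l-1}`, too.
    have hE : En n u = 0 := by
      refine hinj (l - 1) _ (En_mem hu) _ (Submodule.zero_mem _) ?_
      rw [map_zero, ← En_sigma, huw']
      exact hw.1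
    exact ⟨⟨u, hE, hu⟩, Subtype.ext huw'⟩

/-- The automorphism of `W_{n,l}` induced by `σ_i`. -/
def sigmaW {n : ℕ} (l : ℕ) (i : Fin (n - 1)) : W n l ≃ₗ[LL] W n l :=
  LinearEquiv.ofBijective _ (sigma_restrict_W_bijective (l := l) i)

theorem sigmaW_apply {n : ℕ} (l : ℕ) (i : Fin (n - 1)) (w : W n l) :
    (sigmaW l i w : Vpow n) = sigma i (w : Vpow n) := rfl

/-! ### The braid relation for adjacent generators -/

/-- `β` with the entries in the positions `i`, `i + 1 = j`, `j + 1` replaced by `a`, `b`, `c`. -/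
def setTriple {n : ℕ} (i j : Fin (n - 1)) (β : Fin n → ℕ) (a b c : ℕ) : Fin n → ℕ :=
  setPair j (Function.update β (leftPos i) a) b c

theorem setTriple_eq {n : ℕ} {i j : Fin (n - 1)} (hij : (i : ℕ) + 1 = j) (β : Fin n → ℕ)
    (a b c : ℕ) : setTriple i j β a b c = setPair i (Function.update β (rightPos j) c) a b := by
  have h1 : leftPos j = rightPos i := Fin.ext hij.symm
  have h2 : rightPos j ≠ leftPos i := by
    simp only [ne_eq, Fin.ext_iff]; omega
  have h3 : rightPos j ≠ rightPos i := by
    simp only [ne_eq, Fin.ext_iff]; omega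
  rw [setTriple, setPair, setPair, h1, Function.update_comm h2, Function.update_comm h3]

theorem sigma_left_setTriple {n : ℕ} {i j : Fin (n - 1)} (hij : (i : ℕ) + 1 = j)
    (β : Fin n → ℕ) (a b c : ℕ) : sigma i (vt (setTriple i j β a b c)) =
      ∑ m ∈ Finset.range (a + 1), coeffR a b m • vt (setTriple i j β (b + m) (a - m) c) := by
  simp only [setTriple_eq hij]
  exact sigma_vt_setPair i _ a b

theorem sigma_right_setTriple {n : ℕ} (i j : Fin (n - 1)) (β : Fin n → ℕ) (a b c : ℕ) :
    sigma j (vt (setTriple i j β a b c)) =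
      ∑ m ∈ Finset.range (b + 1), coeffR b c m • vt (setTriple i j β a (c + m) (b - m)) :=
  sigma_vt_setPair j _ b c

/-- The coefficients of the braiding of `V ⊗ V` (in degree `d`) with `V` (in degree `c`). -/
def coeffHex (d c N : ℕ) : LL :=
  sp (-((d : ℤ) + 2 * c + N)) * qp (2 * ((d : ℤ) - N) * (c + N)) * qp (tri N) * coeffF N c

/-- The hexagon axiom, on coefficients. -/
theorem coeffR_mul_coeffR (a b c k m : ℕ) : coeffR b c m * coeffR a (c + m) k =
    coeffHex (a + b) c (k + m) * coeffDelta b k m := by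
  have hs : sp (-((b : ℤ) + c)) * sp (-((a : ℤ) + (c + m : ℕ))) =
      sp (-(((a + b : ℕ) : ℤ) + 2 * c + (k + m : ℕ))) * sp k := by
    rw [← sp_add, ← sp_add]; refine congrArg sp ?_; push_cast; ring
  have hq : qp (2 * ((b : ℤ) - m) * (c + m)) * qp (tri m) *
      (qp (2 * ((a : ℤ) - k) * ((c + m : ℕ) + k)) * qp (tri k)) =
      qp (2 * (((a + b : ℕ) : ℤ) - (k + m : ℕ)) * (c + (k + m : ℕ))) * qp (tri (k + m)) *
        (qp ((k : ℤ) * m) * qp (-2 * (b : ℤ) * k)) := by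
    rw [tri_add]
    simp only [← qp_add]
    refine congrArg qp ?_; push_cast; ring
  have hF := coeffF_mul_coeffF k m c
  rw [coeffR, coeffR, coeffHex, coeffDelta]
  generalize sp (-((b : ℤ) + c)) = s1 at *
  generalize sp (-((a : ℤ) + (c + m : ℕ))) = s2 at *
  generalize sp (-(((a + b : ℕ) : ℤ) + 2 * c + (k + m : ℕ))) = s3 at *
  generalize qp (2 * ((b : ℤ) - m) * (c + m)) = q1 at *
  generalize qp (2 * ((a : ℤ) - k) * ((c + m : ℕ) + k)) = q2 at *
  generalize qp (2 * (((a + b : ℕ) : ℤ) - (k + m : ℕ)) * (c + (k + m : ℕ))) = q3 at *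
  generalize qp ((k : ℤ) * m) = q4 at *
  generalize qp (-2 * (b : ℤ) * k) = q5 at *
  generalize coeffF m c = f1 at *
  generalize coeffF k (c + m) = f2 at *
  generalize coeffF (k + m) c = f3 at *
  linear_combination s1 * s2 * q1 * q2 * qp (tri m) * qp (tri k) * hF +
    s1 * s2 * qBinom (k + m) m * f3 * hq +
    q3 * qp (tri (k + m)) * q4 * q5 * qBinom (k + m) m * f3 * hs

/-- The braiding of `V ⊗ V` with `V`, on the product of the degree `d` part of `V ⊗ V` with `v_c`:
the `R`-matrix with `E` replaced by `ΔE`. The factors end up in the positions `j`, `j + 1` and `i`,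
and the other positions are filled according to `β`. -/
def hexMap {n : ℕ} (i j : Fin (n - 1)) (β : Fin n → ℕ) (d c : ℕ) : V ⊗[LL] V →ₗ[LL] Vpow n :=
  ∑ N ∈ Finset.range (d + 1), coeffHex d c N •
    (insertPair j (fun k => v (Function.update β (leftPos i) (c + N) k)) ∘ₗ deltaE ^ N)

theorem hexMap_apply {n : ℕ} (i j : Fin (n - 1)) (β : Fin n → ℕ) (d c : ℕ) (X : V ⊗[LL] V) :
    hexMap i j β d c X = ∑ N ∈ Finset.range (d + 1), coeffHex d c N •
      insertPair j (fun k => v (Function.update β (leftPos i) (c + N) k)) ((deltaE ^ N) X) := by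
  rw [hexMap, LinearMap.sum_apply]
  rfl

theorem insertPair_deltaE_pow {n : ℕ} (i j : Fin (n - 1)) (β : Fin n → ℕ) (a b c N : ℕ) :
    insertPair j (fun k => v (Function.update β (leftPos i) c k))
      ((deltaE ^ N) (v a ⊗ₜ[LL] v b)) =
    ∑ p ∈ Finset.range (a + 1) ×ˢ Finset.range (b + 1) with p.1 + p.2 = N,
      coeffDelta b p.1 p.2 • vt (setTriple i j β c (a - p.1) (b - p.2)) := by
  rw [deltaE_pow_v_tmul_v, map_sum]
  have hset : ({p ∈ Finset.range (a + 1) ×ˢ Finset.range (b + 1) | p.1 + p.2 = N} :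
      Finset (ℕ × ℕ)) =
      {p ∈ Finset.HasAntidiagonal.antidiagonal N | p.1 ≤ a ∧ p.2 ≤ b} := by
    ext p
    simp only [Finset.mem_filter, Finset.mem_product, Finset.mem_range,
      Finset.HasAntidiagonal.mem_antidiagonal]
    omega
  rw [hset, Finset.sum_filter]
  refine Finset.sum_congr rfl fun p _ => ?_
  rw [map_smul, E_pow_v, E_pow_v]
  by_cases h1 : p.1 ≤ a
  · by_cases h2 : p.2 ≤ b
    · rw [if_pos h1, if_pos h2, if_pos ⟨h1, h2⟩, insertPair_v_tmul_v]; rfl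
    · rw [if_pos h1, if_neg h2, if_neg (fun h : p.1 ≤ a ∧ p.2 ≤ b => h2 h.2),
        TensorProduct.tmul_zero, map_zero, smul_zero]
  · rw [if_neg h1, if_neg (fun h : p.1 ≤ a ∧ p.2 ≤ b => h1 h.1),
      TensorProduct.zero_tmul, map_zero, smul_zero]

/-- The hexagon axiom. -/
theorem sigma_sigma_insertPair {n : ℕ} {i j : Fin (n - 1)} (hij : (i : ℕ) + 1 = j)
    (β : Fin n → ℕ) (a b c : ℕ) :
    sigma i (sigma j (insertPair i (fun k => v (Function.update β (rightPos j) c k))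
      (v a ⊗ₜ[LL] v b))) = hexMap i j β (a + b) c (v a ⊗ₜ[LL] v b) := by
  rw [insertPair_v_tmul_v, ← setTriple_eq hij, sigma_right_setTriple, map_sum, hexMap_apply]
  have hleft : ∀ m, sigma i (coeffR b c m • vt (setTriple i j β a (c + m) (b - m))) =
      ∑ k ∈ Finset.range (a + 1), (coeffR b c m * coeffR a (c + m) k) •
        vt (setTriple i j β (c + m + k) (a - k) (b - m)) := by
    intro m
    rw [map_smul, sigma_left_setTriple hij, Finset.smul_sum]
    exact Finset.sum_congr rfl fun k _ => smul_smul _ _ _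
  rw [Finset.sum_congr rfl fun m _ => hleft m, Finset.sum_comm, ← Finset.sum_product',
    ← Finset.sum_fiberwise_of_maps_to (t := Finset.range (a + b + 1)) (g := fun p => p.1 + p.2)]
  · refine Finset.sum_congr rfl fun N _ => ?_
    rw [insertPair_deltaE_pow, Finset.smul_sum]
    refine Finset.sum_congr rfl fun p hp => ?_
    obtain rfl := (Finset.mem_filter.1 hp).2
    rw [coeffR_mul_coeffR, smul_smul, show c + p.2 + p.1 = c + (p.1 + p.2) by omega]
  · intro p hp
    simp only [Finset.mem_product, Finset.mem_range] at hp ⊢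
    omega

/-- Naturality of the braiding of `V ⊗ V` with `V`. -/
theorem sigma_hexMap {n : ℕ} (i j : Fin (n - 1)) (β : Fin n → ℕ) (d c : ℕ) (X : V ⊗[LL] V) :
    sigma j (hexMap i j β d c X) = hexMap i j β d c (R X) := by
  rw [hexMap_apply, hexMap_apply, map_sum]
  refine Finset.sum_congr rfl fun N _ => ?_
  rw [map_smul, sigma_insertPair, ← LinearMap.comp_apply R, R_comp_deltaE_pow,
    LinearMap.comp_apply]

theorem sigma_sigma_insertPair_R {n : ℕ} {i j : Fin (n - 1)} (hij : (i : ℕ) + 1 = j)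
    (β : Fin n → ℕ) (a b c : ℕ) :
    sigma i (sigma j (insertPair i (fun k => v (Function.update β (rightPos j) c k))
      (R (v a ⊗ₜ[LL] v b)))) = hexMap i j β (a + b) c (R (v a ⊗ₜ[LL] v b)) := by
  rw [R_v_tmul_v, map_sum, map_sum, map_sum, map_sum]
  refine Finset.sum_congr rfl fun m hm => ?_
  rw [Finset.mem_range] at hm
  rw [map_smul, map_smul, map_smul, map_smul, sigma_sigma_insertPair hij,
    show b + m + (a - m) = a + b by omega]

theorem sigma_braid {n : ℕ} {i j : Fin (n - 1)} (hij : (i : ℕ) + 1 = j) (y : Vpow n) :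
    sigma i (sigma j (sigma i y)) = sigma j (sigma i (sigma j y)) := by
  have h : sigma i ∘ₗ sigma j ∘ₗ sigma i = sigma j ∘ₗ sigma i ∘ₗ sigma j := by
    refine vpow_ext fun β => ?_
    simp only [LinearMap.comp_apply]
    have hu : (fun k => v (β k)) =
        fun k => v (Function.update β (rightPos j) (β (rightPos j)) k) := by
      rw [Function.update_eq_self]
    rw [vt_eq_insertPair i β, sigma_insertPair, hu, sigma_sigma_insertPair_R hij,
      sigma_sigma_insertPair hij, sigma_hexMap]
  exact LinearMap.congr_fun h y

/-! ### Distant generators commute -/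

theorem setPair_comm {n : ℕ} {i j : Fin (n - 1)} (hij : (i : ℕ) + 1 < j) (β : Fin n → ℕ)
    (a b c d : ℕ) : setPair j (setPair i β a b) c d = setPair i (setPair j β c d) a b := by
  have h1 : leftPos j ≠ leftPos i := by simp only [ne_eq, Fin.ext_iff]; omega
  have h2 : leftPos j ≠ rightPos i := by simp only [ne_eq, Fin.ext_iff]; omega
  have h3 : rightPos j ≠ leftPos i := by simp only [ne_eq, Fin.ext_iff]; omega
  have h4 : rightPos j ≠ rightPos i := by simp only [ne_eq, Fin.ext_iff]; omega
  refine (eq_setPair j _ c d ?_ ?_ fun k hk1 hk2 => ?_).symm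
  · rw [setPair_of_ne i _ a b h1 h2, setPair_left]
  · rw [setPair_of_ne i _ a b h3 h4, setPair_right]
  · by_cases e1 : k = leftPos i
    · rw [e1, setPair_left, setPair_left]
    by_cases e2 : k = rightPos i
    · rw [e2, setPair_right, setPair_right]
    rw [setPair_of_ne i _ a b e1 e2, setPair_of_ne i _ a b e1 e2, setPair_of_ne j _ c d hk1 hk2]

theorem sigma_comm {n : ℕ} {i j : Fin (n - 1)} (hij : (i : ℕ) + 1 < j) (y : Vpow n) :
    sigma i (sigma j y) = sigma j (sigma i y) := by
  have h : sigma i ∘ₗ sigma j = sigma j ∘ₗ sigma i := by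
    refine vpow_ext fun β => ?_
    have hβ : ∃ a b c d, β = setPair j (setPair i β a b) c d :=
      ⟨_, _, β (leftPos j), β (rightPos j), by rw [setPair_self i, setPair_self j]⟩
    obtain ⟨a, b, c, d, hβ⟩ := hβ
    rw [hβ, LinearMap.comp_apply, LinearMap.comp_apply, sigma_vt_setPair, setPair_comm hij,
      sigma_vt_setPair, map_sum, map_sum]
    simp only [map_smul, setPair_comm hij, sigma_vt_setPair]
    simp only [← setPair_comm hij, sigma_vt_setPair, Finset.smul_sum]
    rw [Finset.sum_comm]
    exact Finset.sum_congr rfl fun k _ => Finset.sum_congr rfl fun m _ => smul_comm _ _ _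
  exact LinearMap.congr_fun h y

/-! ### The action of the braid group -/

/-- The action of the braid group on `W_{n,l}`. -/
def braidAction (n l : ℕ) : BraidGroup n →* (W n l ≃ₗ[LL] W n l) :=
  PresentedGroup.toGroup (f := sigmaW l) (by
    rintro r (⟨i, j, hij, rfl⟩ | ⟨i, j, hij, rfl⟩)
    · rw [map_mul, map_inv, mul_inv_eq_one]
      simp only [map_mul, FreeGroup.lift_apply_of]
      exact LinearEquiv.ext fun w => Subtype.ext (sigma_braid hij (w : Vpow n))
    · rw [map_mul, map_inv, mul_inv_eq_one]
      simp only [map_mul, FreeGroup.lift_apply_of]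
      exact LinearEquiv.ext fun w => Subtype.ext (sigma_comm hij (w : Vpow n)))

theorem braidAction_artin {n l : ℕ} (i : Fin (n - 1)) (w : W n l) :
    (braidAction n l (artin i) w : Vpow n) = sigma i (w : Vpow n) := by
  rw [braidAction, artin, PresentedGroup.toGroup.of, sigmaW_apply]

end QVerma

end

theorem theorem1 (n l : ℕ) (hn : 1 ≤ n) :
    -- the elements `E⁻¹ x` that enter the definition of `Φ` exist and are unique
    (∀ m k : ℕ, 1 ≤ m → ∀ x ∈ QVerma.weightSpace m k,
      ∃! η : QVerma.Vpow m, η ∈ QVerma.spanB m (k + 1) ∧ QVerma.En m η = x) ∧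
    -- `W_{n,l}` is free, with basis the `Φ (a)`, of the asserted rank
    Module.Free QVerma.LL (QVerma.W n l) ∧
    Module.finrank QVerma.LL (QVerma.W n l) = (n + l - 2).choose l ∧
    ∃ (b : Module.Basis (QVerma.setA n l) QVerma.LL (QVerma.W n l))
      (e : QVerma.setA n l ≃ Fin ((n + l - 2).choose l)),
      (∀ β : QVerma.setA n l,
        (b β : QVerma.Vpow n) = QVerma.Phi n (QVerma.vt (β : Fin n → ℕ))) ∧
      -- the braid group acts on `W_{n,l}`, the generators acting through the operators `σ_i`
      ∃ (Ψ : QVerma.BraidGroup n →* (QVerma.W n l ≃ₗ[QVerma.LL] QVerma.W n l))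
        (ρ : QVerma.BraidGroup n →* GL (Fin ((n + l - 2).choose l)) QVerma.LL),
        (∀ (i : Fin (n - 1)) (w : QVerma.W n l),
          (Ψ (QVerma.artin i) w : QVerma.Vpow n) = QVerma.sigma i (w : QVerma.Vpow n)) ∧
        ∀ g : QVerma.BraidGroup n,
          (ρ g : Matrix (Fin ((n + l - 2).choose l)) (Fin ((n + l - 2).choose l)) QVerma.LL) =
            LinearMap.toMatrix (b.reindex e) (b.reindex e)
              (Ψ g : QVerma.W n l →ₗ[QVerma.LL] QVerma.W n l) := by
  have := QVerma.finite_setA n l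
  have : Finite (QVerma.setA n l) := this
  have hcard : Nat.card (QVerma.setA n l) = (n + l - 2).choose l := QVerma.ncard_setA hn l
  let b := QVerma.basisW hn l
  let e := Finite.equivFinOfCardEq hcard
  refine ⟨fun m k hm x hx => QVerma.existsUnique_En_eq hm k hx, Module.Free.of_basis b,
    (Module.finrank_eq_nat_card_basis b).trans hcard, b, e, QVerma.basisW_apply hn l,
    QVerma.braidAction n l,
    (Units.map (LinearMap.toMatrixAlgEquiv (b.reindex e)).toAlgHom.toMonoidHom).comp
      ((LinearMap.GeneralLinearGroup.generalLinearEquiv QVerma.LL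
        (QVerma.W n l)).symm.toMonoidHom.comp (QVerma.braidAction n l)),
    QVerma.braidAction_artin, fun g => rfl⟩
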